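/- Let $K$ be an arbitrary field. A numerical semigroup is a submonoid $\mathcal S=\langle A\rangle$ of $\mathbb N$ generated by a finite set $A=\{a_1,\dots,a_n\}$ of relatively prime positive integers; $A$ is always taken to be its (unique) minimal generating set, i.e. no proper subset of $A$ generates $\mathcal S$. The $A$-degree of $\mathbf x^{\mathbf u}=x_1^{u_1}\cdots x_n^{u_n}$ is $u_1a_1+\cdots+u_na_n$, and the toric ideal $I_A\subseteq K[x_1,\dots,x_n]$ is generated by all $\mathbf x^{\mathbf u}-\mathbf x^{\mathbf v}$ with $\mathbf x^{\mathbf u},\mathbf x^{\mathbf v}$ of the same $A$-degree. A binomial is a difference $\mathbf x^{\mathbf u}-\mathbf x^{\mathbf v}$ with $\mathbf u\neq\mathbf v$. Define: - $\operatorname{Gr}_A$ (Graver basis): the set of primitive binomials of $I_A$, i.e. those $\mathbf x^{\mathbf u}-\mathbf x^{\mathbf v}\in I_A$ for which there is no other binomial $\mathbf x^{\mathbf w}-\mathbf x^{\mathbf z}\in I_A$ with $\mathbf x^{\mathbf w}\mid\mathbf x^{\mathbf u}$ and $\mathbf x^{\mathbf z}\mid\mathbf x^{\mathbf v}$; - $\mathcal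 M_A$ (universal Markov basis): the union of all Markov bases of $I_A$, a Markov basis being an inclusion-minimal generating set of $I_A$ consisting of binomials; the $A$-degrees of the elements of Markov bases are the Betti degrees of $I_A$; - $\mathcal U_A$ (universal Gröbner basis): the union of the reduced Gröbner bases of $I_A$ over all monomial orders; - $\mathcal C_A$ (circuits): the set of binomials $\mathbf x^{\mathbf u}-\mathbf x^{\mathbf v}\in I_A$ such that $\operatorname{supp}\mathbf u\cap\operatorname{supp}\mathbf v=\emptyset$, the nonzero entries of $\mathbf u+\mathbf v$ are relatively prime, and no binomial $\mathbf x^{\mathbf u'}-\mathbf x^{\mathbf v'}\in I_A$ satisfies $\operatorname{supp}\mathbf u'\cup\operatorname{supp}\mathbf v'\subsetneq\operatorname{supp}\mathbf u\cup\operatorname{supp}\mathbf v$. The semigroup $\mathcal S$ is free for the arrangement $(a_1,\dots,a_n)$ of $A$ if $\operatorname{lcm}\big(a_i,\gcd(a_{i+1},\dots,a_n)\big)\in\langle a_{i+1},\dots,a_n\rangle$ for all $1\le i\le n-1$, and it is universally free if it is free for every arrangement of the elements of $A$. Consider the following families of numerical semigroups $\mathcal S=\langle A\rangle$: - $\mathcal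 F_0$: Betti divisible ones, i.e. for any two Betti degrees of $I_A$ one divides the other; - $\mathcal F_1$: those with $\mathcal M_A=\operatorname{Gr}_A$; - $\mathcal F_2$: those with $\mathcal C_A=\mathcal U_A$; - $\mathcal F_3$: the universally free ones; - $\mathcal F_4$: those with $\mathcal C_A\subseteq\mathcal M_A$; - $\mathcal F_5$: the circuit ones, i.e. those for which $I_A$ is generated by $\mathcal C_A$. Then (a) $\mathcal F_0\subsetneq\mathcal F_1\cap\mathcal F_2$; (b) $\mathcal F_1\cup\mathcal F_3\subseteq\mathcal F_4$; (c) $\mathcal F_2\subseteq\mathcal F_3\subsetneq\mathcal F_5$. -/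

import Mathlib

namespace ToricSemigroup

open MvPolynomial

/-! ## Numerical semigroups and their minimal generating sets -/

/-- `A` is the minimal generating set of the numerical semigroup `S`: `A` is a finite set of
relatively prime positive integers that generates the submonoid `S` of `ℕ`, and no proper subset
of `A` generates `S`. (Since `Finset.gcd ∅ = 0`, the set `A` is nonempty.) -/
def IsMinGenSet (A : Finset ℕ) (S : AddSubmonoid ℕ) : Prop :=
  (∀ a ∈ A, 0 < a) ∧ A.gcd id = 1 ∧ AddSubmonoid.closure (A : Set ℕ) = S ∧
    ∀ B : Finset ℕ, B ⊂ A → AddSubmonoid.closure (B : Set ℕ) ≠ S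

/-- The family of all numerical semigroups whose minimal generating set has the property `P`. -/
def family (P : Finset ℕ → Prop) : Set (AddSubmonoid ℕ) :=
  {S | ∃ A : Finset ℕ, IsMinGenSet A S ∧ P A}

/-! ## Free and universally free semigroups -/

/-- Freeness for the arrangement `(a 0, …, a (n - 1))`: for every index `i` but the last one,
`lcm (a i, gcd {a j | j > i})` lies in the semigroup generated by the `a j` with `j > i`. -/
def FreeFor {n : ℕ} (a : Fin n → ℕ) : Prop :=
  ∀ i : Fin n, (i : ℕ) + 1 < n →
    Nat.lcm (a i) ((Finset.Ioi i).gcd a) ∈ AddSubmonoid.closure (a '' Set.Ioi i)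

/-- Freeness for every arrangement of the elements of `A`. -/
def UniversallyFree (A : Finset ℕ) : Prop :=
  ∀ e : Fin A.card ≃ A, FreeFor (fun i => (e i : ℕ))

/-! ## The toric ideal

The polynomial ring has one variable for each element of `A`. -/

section Toric

variable (K : Type*) [Field K] (A : Finset ℕ)

/-- The `A`-degree of the monomial with exponent vector `u`. -/
def degA {A : Finset ℕ} (u : A →₀ ℕ) : ℕ := ∑ a : A, u a * (a : ℕ)

/-- The pure difference `x ^ u - x ^ v`. -/
noncomputable def binom {A : Finset ℕ} (u v : A →₀ ℕ) : MvPolynomial A K :=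
  monomial u 1 - monomial v 1

/-- The toric ideal of `A`. -/
noncomputable def toricIdeal : Ideal (MvPolynomial A K) :=
  Ideal.span {f | ∃ u v : A →₀ ℕ, degA u = degA v ∧ f = binom K u v}

/-! ## Toric bases

A binomial is a (nonzero) pure difference of two distinct monomials. -/

/-- `x ^ u - x ^ v` is a primitive binomial of the toric ideal: no other binomial
`x ^ w - x ^ z` of the ideal has `x ^ w ∣ x ^ u` and `x ^ z ∣ x ^ v`. -/
def IsPrimitive {A : Finset ℕ} (u v : A →₀ ℕ) : Prop :=
  u ≠ v ∧ binom K u v ∈ toricIdeal K A ∧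
    ∀ w z : A →₀ ℕ, w ≠ z → binom K w z ∈ toricIdeal K A → w ≤ u → z ≤ v → w = u ∧ z = v

/-- The Graver basis: the set of primitive binomials. -/
def graverBasis : Set (MvPolynomial A K) :=
  {f | ∃ u v : A →₀ ℕ, IsPrimitive K u v ∧ f = binom K u v}

/-- A Markov basis: a generating set of the toric ideal that consists of binomials and is minimal
with respect to inclusion among such generating sets. -/
def IsMarkovBasis (B : Set (MvPolynomial A K)) : Prop :=
  Minimal (fun B : Set (MvPolynomial A K) =>
    (∀ f ∈ B, ∃ u v : A →₀ ℕ, u ≠ v ∧ f = binom K u v) ∧ Ideal.span B = toricIdeal K A) B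

/-- The universal Markov basis: the union of all Markov bases. -/
def universalMarkovBasis : Set (MvPolynomial A K) :=
  {f | ∃ B : Set (MvPolynomial A K), IsMarkovBasis K A B ∧ f ∈ B}

/-- The Betti degrees: the `A`-degrees of the binomials that occur in Markov bases. -/
def bettiDegrees : Set ℕ :=
  {b | ∃ u v : A →₀ ℕ, u ≠ v ∧ binom K u v ∈ universalMarkovBasis K A ∧ b = degA u}

/-- `x ^ u - x ^ v` is a circuit: an irreducible binomial of the toric ideal (disjoint supports,
relatively prime exponents) such that no binomial of the ideal has strictly smaller support. -/
def IsCircuit {A : Finset ℕ} (u v : A →₀ ℕ) : Prop :=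
  u ≠ v ∧ binom K u v ∈ toricIdeal K A ∧
    Disjoint u.support v.support ∧ (u + v).support.gcd (u + v) = 1 ∧
    ∀ w z : A →₀ ℕ, w ≠ z → binom K w z ∈ toricIdeal K A →
      ¬ w.support ∪ z.support ⊂ u.support ∪ v.support

/-- The set of circuits of the toric ideal. -/
def circuits : Set (MvPolynomial A K) :=
  {f | ∃ u v : A →₀ ℕ, IsCircuit K u v ∧ f = binom K u v}

/-- `G` is the reduced Gröbner basis of `I` with respect to `m`: a subset of `I` whose leading
terms generate the initial ideal of `I`, whose elements are monic, and such that no monomial of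
an element is divisible by the leading monomial of another element. (In finitely many variables
such a `G` is automatically finite.) -/
def IsReducedGroebnerBasis {K : Type*} [Field K] {σ : Type*} (m : MonomialOrder σ)
    (I : Ideal (MvPolynomial σ K)) (G : Set (MvPolynomial σ K)) : Prop :=
  G ⊆ (I : Set (MvPolynomial σ K)) ∧
    Ideal.span (m.leadingTerm '' G) =
      Ideal.span (m.leadingTerm '' (I : Set (MvPolynomial σ K))) ∧
    ∀ f ∈ G, m.Monic f ∧ ∀ d ∈ f.support, ∀ g ∈ G, g ≠ f → ¬ m.degree g ≤ d

/-- The universal Gröbner basis: the union of the reduced Gröbner bases of the toric ideal over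
all monomial orders. (Every monomial order on the countable set `A →₀ ℕ` is isomorphic to one
whose carrier lives in `Type`.) -/
def universalGroebnerBasis : Set (MvPolynomial A K) :=
  {f | ∃ (m : MonomialOrder.{0, 0} A) (G : Set (MvPolynomial A K)),
    IsReducedGroebnerBasis m (toricIdeal K A) G ∧ f ∈ G}

end Toric

/-! ## The families of numerical semigroups -/

section Families

variable (K : Type*) [Field K]

/-- Betti divisible numerical semigroups: the Betti degrees are totally ordered by
divisibility. -/
def F0 : Set (AddSubmonoid ℕ) :=
  family fun A => ∀ b ∈ bettiDegrees K A, ∀ c ∈ bettiDegrees K A, b ∣ c ∨ c ∣ b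

/-- The universal Markov basis equals the Graver basis. -/
def F1 : Set (AddSubmonoid ℕ) :=
  family fun A => universalMarkovBasis K A = graverBasis K A

/-- The set of circuits equals the universal Gröbner basis. -/
def F2 : Set (AddSubmonoid ℕ) :=
  family fun A => circuits K A = universalGroebnerBasis K A

/-- Universally free numerical semigroups. -/
def F3 : Set (AddSubmonoid ℕ) :=
  family fun A => UniversallyFree A

/-- Every circuit belongs to the universal Markov basis. -/
def F4 : Set (AddSubmonoid ℕ) :=
  family fun A => circuits K A ⊆ universalMarkovBasis K A

/-- Circuit numerical semigroups: the toric ideal is generated by its circuits. -/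
def F5 : Set (AddSubmonoid ℕ) :=
  family fun A => toricIdeal K A = Ideal.span (circuits K A)

end Families

end ToricSemigroup

namespace ToricSemigroup

open MvPolynomial

/-! ## Degrees and binomials -/

section Degree

variable {A : Finset ℕ}

/-! Everything becomes combinatorics of the fibers of the `A`-degree, and the field plays no role. A
pure difference lies in the toric ideal iff its monomials have equal degree
(`binom_mem_toricIdeal`). Join monomials of equal degree that share a variable. The universal Markov
basis consists of the pairs in one fiber but in different components (`mem_universalMarkovBasis`).
Circuits are the pairs `circ i j`, `circ j i` of pure powers of degree `lcm (a_i, a_j)`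
(`mem_circuits`). Elements of reduced Gröbner bases pair a minimal nonstandard monomial with the
standard monomial of its degree (`mem_universalGroebnerBasis`).

Freeness supplies a rule that trades a power of `x_k` for a monomial in the variables of `T`, for
every `T` and `k ∉ T`. Applied to chains of links, the rules eliminate all variables but two, and
there `circ i j` is isolated; hence circuits are Markov (`not_conn_circ`). Applied to one component,
they show that in a disconnected fiber every component contains a pure power (`exists_conn_single`),
and pure powers of equal degree differ by a power of a circuit; hence circuits generate.

If all reduced Gröbner elements are circuits, an elimination order with `T` smallest and `k` next
yields a circuit on `k` and some `j ∈ T` with `lcm (k, gcd T) = lcm (k, j)`, which is freeness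
(`freeStep_of_universalGroebnerBasis_subset`).

For Betti divisible semigroups let `c i` be the least positive number with `c i * a_i` generated by
the other generators. These products are Betti degrees, and their being a chain forces exponents in
a fiber to be congruent modulo `c` (`exists_isScaling`, `IsScaling.modEq`). Primitive binomials are
thus made of blocks `x_i ^ c i`. Since block degrees form a divisibility chain, one side of a
primitive binomial is a single block, which is isolated in its fiber, and both sides of a reduced
Gröbner element are pure powers.

Strictness: `60, 84, 350, 525` has two incomparable block degrees, `420` and `1050`, yet the block
argument survives; `4, 6, 9` is generated by circuits, but `6 ∉ ⟨4, 9⟩` although `gcd (4, 9) = 1`.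
-/

@[simp] lemma degA_zero : degA (0 : A →₀ ℕ) = 0 := by simp [degA]

@[simp] lemma degA_add (u v : A →₀ ℕ) : degA (u + v) = degA u + degA v := by
  simp [degA, add_mul, Finset.sum_add_distrib]

@[simp] lemma degA_nsmul (n : ℕ) (u : A →₀ ℕ) : degA (n • u) = n * degA u := by
  simp [degA, Finset.mul_sum, mul_assoc]

@[simp] lemma degA_single (i : A) (n : ℕ) : degA (Finsupp.single i n) = n * i := by
  classical
  simp [degA, Finsupp.single_apply]

lemma degA_sub {u w : A →₀ ℕ} (h : w ≤ u) : degA (u - w) + degA w = degA u := by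
  rw [← degA_add, tsub_add_cancel_of_le h]

lemma degA_mono {u v : A →₀ ℕ} (h : u ≤ v) : degA u ≤ degA v := by
  rw [← degA_sub h]; omega

lemma degA_eq_zero (hpos : ∀ a ∈ A, 0 < a) {u : A →₀ ℕ} : degA u = 0 ↔ u = 0 := by
  refine ⟨fun h => ?_, fun h => by simp [h]⟩
  ext a
  have := (Finset.sum_eq_zero_iff.mp h) a (Finset.mem_univ _)
  have h2 := hpos a a.2
  simp only [mul_eq_zero] at this
  rcases this with h | h
  · simpa using h
  · omega

lemma eq_of_le_of_degA_eq (hpos : ∀ a ∈ A, 0 < a) {u v : A →₀ ℕ} (h : u ≤ v)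
    (hd : degA u = degA v) : u = v := by
  have h1 := degA_sub h
  have h2 : v - u = 0 := (degA_eq_zero hpos).1 (by omega)
  exact le_antisymm h (tsub_eq_zero_iff_le.1 h2)

lemma degA_lt_of_lt (hpos : ∀ a ∈ A, 0 < a) {u v : A →₀ ℕ} (h : u < v) : degA u < degA v :=
  lt_of_le_of_ne (degA_mono h.le) fun e => h.ne (eq_of_le_of_degA_eq hpos h.le e)

lemma single_le_of_le {u : A →₀ ℕ} {i : A} {n : ℕ} (h : n ≤ u i) : Finsupp.single i n ≤ u := by
  classical
  intro a
  rw [Finsupp.single_apply]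
  split_ifs with e
  · exact e ▸ h
  · exact Nat.zero_le _

lemma dvd_degA {u : A →₀ ℕ} {d : ℕ} (h : ∀ a ∈ u.support, d ∣ u a * a) : d ∣ degA u := by
  refine Finset.dvd_sum fun a _ => ?_
  by_cases ha : a ∈ u.support
  · exact h a ha
  · simp [Finsupp.notMem_support_iff.1 ha]

end Degree

section Binomials

variable (K : Type*) [Field K] {A : Finset ℕ}

/-- The `A`-grading homomorphism to the univariate polynomials. -/
noncomputable def degHom (A : Finset ℕ) : MvPolynomial A K →ₐ[K] Polynomial K :=
  aeval fun a : A => (Polynomial.X : Polynomial K) ^ (a : ℕ)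

lemma degHom_monomial (u : A →₀ ℕ) (c : K) :
    degHom K A (monomial u c) = Polynomial.monomial (degA u) c := by
  rw [degHom, aeval_monomial, Finsupp.prod_fintype _ _ (by simp), ← Polynomial.C_mul_X_pow_eq_monomial]
  simp only [← pow_mul, Finset.prod_pow_eq_pow_sum, degA, Polynomial.algebraMap_eq]
  congr 2
  exact Finset.sum_congr rfl fun a _ => mul_comm _ _

lemma degHom_eq_zero {f : MvPolynomial A K} (hf : f ∈ toricIdeal K A) : degHom K A f = 0 := by
  have : toricIdeal K A ≤ RingHom.ker (degHom K A) := by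
    refine Ideal.span_le.2 ?_
    rintro _ ⟨u, v, h, rfl⟩
    simp [binom, degHom_monomial, h]
  exact this hf

lemma binom_mem_toricIdeal {u v : A →₀ ℕ} : binom K u v ∈ toricIdeal K A ↔ degA u = degA v := by
  refine ⟨fun h => ?_, fun h => Ideal.subset_span ⟨u, v, h, rfl⟩⟩
  have := degHom_eq_zero K h
  rw [binom, map_sub, degHom_monomial, degHom_monomial, sub_eq_zero] at this
  by_contra hne
  have := congrArg (fun p => p.coeff (degA u)) this
  simp [Polynomial.coeff_monomial, Ne.symm hne] at this

/-- Every monomial of an element of the toric ideal has a companion of the same degree. -/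
lemma exists_companion {f : MvPolynomial A K} (hf : f ∈ toricIdeal K A) {u : A →₀ ℕ}
    (hu : u ∈ f.support) : ∃ v ∈ f.support, v ≠ u ∧ degA v = degA u := by
  by_contra! hc
  have h := congrArg (fun p => p.coeff (degA u)) (degHom_eq_zero K hf)
  rw [f.as_sum, map_sum] at h
  simp only [degHom_monomial, Polynomial.finsetSum_coeff, Polynomial.coeff_monomial,
    Polynomial.coeff_zero] at h
  rw [Finset.sum_eq_single_of_mem u hu] at h
  · simp only [if_true] at h
    exact (mem_support_iff.1 hu) h
  · intro v hv hne
    rw [if_neg (hc v hv hne)]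

lemma coeff_binom [DecidableEq (A →₀ ℕ)] (u v w : A →₀ ℕ) :
    coeff w (binom K u v) = (if u = w then 1 else 0) - (if v = w then 1 else 0) := by
  simp only [binom, coeff_sub, coeff_monomial]
  congr

lemma support_binom [DecidableEq (A →₀ ℕ)] {u v : A →₀ ℕ} (h : u ≠ v) :
    (binom K u v).support = {u, v} := by
  ext w
  rw [mem_support_iff, coeff_binom, Finset.mem_insert, Finset.mem_singleton]
  by_cases h1 : u = w
  · have h2 : v ≠ w := fun e => h (h1.trans e.symm)
    simp [h1, h2]
  · by_cases h2 : v = w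
    · simp [h1, h2]
    · simp [h1, h2, Ne.symm h1, Ne.symm h2]

lemma binom_swap (u v : A →₀ ℕ) : binom K v u = -binom K u v := by
  simp [binom]

lemma binom_inj {u v u' v' : A →₀ ℕ} (h : u ≠ v) (he : binom K u v = binom K u' v') :
    (u' = u ∧ v' = v) ∨ (u' = v ∧ v' = u) := by
  classical
  have hne : u' ≠ v' := by
    rintro rfl
    have := support_binom K h
    rw [he, binom, sub_self, support_zero] at this
    exact Finset.insert_ne_empty _ _ this.symm
  have hs := support_binom K h
  rw [he, support_binom K hne] at hs
  have h1 : u' ∈ ({u, v} : Finset (A →₀ ℕ)) := hs ▸ by simp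
  have h2 : v' ∈ ({u, v} : Finset (A →₀ ℕ)) := hs ▸ by simp
  simp only [Finset.mem_insert, Finset.mem_singleton] at h1 h2
  rcases h1 with h1 | h1 <;> rcases h2 with h2 | h2
  · exact absurd (h1.trans h2.symm) hne
  · exact Or.inl ⟨h1, h2⟩
  · exact Or.inr ⟨h1, h2⟩
  · exact absurd (h1.trans h2.symm) hne

/-! ## Congruences and ideals generated by binomials -/

/-- The congruence of all pairs whose difference of monomials lies in an ideal. -/
def idealCon (J : Ideal (MvPolynomial A K)) : AddCon (A →₀ ℕ) where
  r u v := binom K u v ∈ J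
  iseqv :=
    { refl := fun u => by simp [binom]
      symm := fun {u v} h => by rw [binom_swap]; exact J.neg_mem h
      trans := fun {u v w} h1 h2 => by
        have : binom K u w = binom K u v + binom K v w := by simp [binom]
        rw [this]; exact J.add_mem h1 h2 }
  add' := fun {u v w z} h1 h2 => by
    have : binom K (u + w) (v + z) =
        monomial w 1 * binom K u v + monomial v 1 * binom K w z := by
      simp only [binom, mul_sub, monomial_mul, mul_one, add_comm]
      ring
    rw [this]
    exact J.add_mem (J.mul_mem_left _ h1) (J.mul_mem_left _ h2)

/-- The span of `B` dies in the monoid algebra of the quotient by `R`, where distinct classes remain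
distinct basis elements. -/
lemma con_of_mem_span (R : AddCon (A →₀ ℕ)) {B : Set (MvPolynomial A K)}
    (hB : ∀ f ∈ B, ∃ u v, R u v ∧ f = binom K u v) {u v : A →₀ ℕ}
    (h : binom K u v ∈ Ideal.span B) : R u v := by
  classical
  let ψ : MvPolynomial A K →+* AddMonoidAlgebra K R.Quotient :=
    AddMonoidAlgebra.mapDomainRingHom K R.mk'
  have hψ : ∀ w : A →₀ ℕ, ψ (monomial w 1) = AddMonoidAlgebra.single (R.mk' w) 1 := fun w => by
    simp only [ψ, AddMonoidAlgebra.mapDomainRingHom_apply]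
    exact AddMonoidAlgebra.mapDomain_single
  have hle : Ideal.span B ≤ RingHom.ker ψ := by
    refine Ideal.span_le.2 fun f hf => ?_
    obtain ⟨w, z, hwz, rfl⟩ := hB f hf
    have : R.mk' w = R.mk' z := R.eq.2 hwz
    simp [binom, hψ, this]
  have h2 := hle h
  rw [RingHom.mem_ker, binom, map_sub, hψ, hψ, sub_eq_zero] at h2
  have h3 : R.mk' u = R.mk' v := by
    by_contra hne
    have := congrArg (fun f => f.coeff (R.mk' u)) h2
    simp only [AddMonoidAlgebra.coeff_single, Finsupp.single_apply, if_neg (Ne.symm hne), if_true]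
      at this
    exact one_ne_zero this
  exact R.eq.1 h3

end Binomials

/-! ## Connectivity in fibers -/

section Connectivity

variable {A : Finset ℕ}

/-- Two exponent vectors of the same degree that share a variable. -/
def Linked (u v : A →₀ ℕ) : Prop := degA u = degA v ∧ ∃ a, 0 < u a ∧ 0 < v a

/-- The connected components of the fibers of the degree, with respect to `Linked`. -/
def Conn : (A →₀ ℕ) → (A →₀ ℕ) → Prop := Relation.ReflTransGen Linked

lemma Linked.symm {u v : A →₀ ℕ} (h : Linked u v) : Linked v u :=
  ⟨h.1.symm, h.2.imp fun _ ha => ha.symm⟩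

lemma Conn.refl (u : A →₀ ℕ) : Conn u u := Relation.ReflTransGen.refl

lemma Linked.conn {u v : A →₀ ℕ} (h : Linked u v) : Conn u v := Relation.ReflTransGen.single h

lemma Conn.trans {u v w : A →₀ ℕ} (h : Conn u v) (h' : Conn v w) : Conn u w :=
  Relation.ReflTransGen.trans h h'

lemma Conn.symm {u v : A →₀ ℕ} (h : Conn u v) : Conn v u := by
  induction h with
  | refl => exact Conn.refl _
  | tail _ h ih => exact h.symm.conn.trans ih

lemma Conn.degA_eq {u v : A →₀ ℕ} (h : Conn u v) : degA u = degA v := by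
  induction h with
  | refl => rfl
  | tail _ h ih => exact ih.trans h.1

lemma exists_pos_of_ne_zero {u : A →₀ ℕ} (h : u ≠ 0) : ∃ a, 0 < u a := by
  obtain ⟨a, ha⟩ := Finsupp.ne_iff.1 h
  exact ⟨a, Nat.pos_of_ne_zero ha⟩

lemma linked_add_left {u v w : A →₀ ℕ} (h : degA u = degA v) (hw : w ≠ 0) :
    Linked (u + w) (v + w) := by
  obtain ⟨a, ha⟩ := exists_pos_of_ne_zero hw
  exact ⟨by simp [h], a, by simp [ha], by simp [ha]⟩

/-- Pairs of vectors that a given connected component does not separate. -/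
def compCon (hpos : ∀ a ∈ A, 0 < a) (v₀ : A →₀ ℕ) : AddCon (A →₀ ℕ) where
  r u v := degA u = degA v ∧ (Conn v₀ u ↔ Conn v₀ v)
  iseqv :=
    { refl := fun _ => ⟨rfl, Iff.rfl⟩
      symm := fun h => ⟨h.1.symm, h.2.symm⟩
      trans := fun h h' => ⟨h.1.trans h'.1, h.2.trans h'.2⟩ }
  -- Unless a summand vanishes, the sums are joined by the two links `w + y`, `x + y`, `x + z`, so
  -- no component separates them.
  add' := fun {w x y z} h1 h2 => by
    refine ⟨by simp [h1.1, h2.1], ?_⟩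
    by_cases hy : y = 0
    · have hz : z = 0 := (degA_eq_zero hpos).1 (by rw [← h2.1, hy, degA_zero])
      simpa [hy, hz] using h1.2
    by_cases hx : x = 0
    · have hw : w = 0 := (degA_eq_zero hpos).1 (by rw [h1.1, hx, degA_zero])
      simpa [hx, hw] using h2.2
    have h3 : Conn (w + y) (x + z) := by
      refine (linked_add_left h1.1 hy).conn.trans ?_
      rw [add_comm x y, add_comm x z]
      exact (linked_add_left h2.1 hx).conn
    exact ⟨fun h => h.trans h3, fun h => h.trans h3.symm⟩

/-- A congruence containing all pairs of equal degree less than `d` contains all connected pairs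
of degree `d`. -/
lemma con_of_conn {R : AddCon (A →₀ ℕ)} (hpos : ∀ a ∈ A, 0 < a) {u v : A →₀ ℕ}
    (hR : ∀ w z : A →₀ ℕ, degA w = degA z → degA w < degA u → R w z) (h : Conn u v) : R u v := by
  induction h with
  | refl => exact R.refl _
  | @tail w z huw hwz ih =>
    refine R.trans ih ?_
    obtain ⟨hd, a, ha, hb⟩ := hwz
    -- Dividing both monomials by the shared variable lowers the degree, where the hypothesis
    -- applies.
    have hw : Finsupp.single a 1 ≤ w := single_le_of_le ha
    have hz : Finsupp.single a 1 ≤ z := single_le_of_le hb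
    have h1 := degA_sub hw
    have h2 := degA_sub hz
    have h3 := Conn.degA_eq huw
    have h4 := hpos a a.2
    rw [degA_single] at h1 h2
    have := R.add (hR (w - Finsupp.single a 1) (z - Finsupp.single a 1) (by omega) (by omega))
      (R.refl (Finsupp.single a 1))
    rwa [tsub_add_cancel_of_le hw, tsub_add_cancel_of_le hz] at this

/-- A congruence whose classes refine the degree and which connects the components of
every fiber contains all pairs of equal degree. -/
lemma con_of_components {R : AddCon (A →₀ ℕ)} (hpos : ∀ a ∈ A, 0 < a)
    (hR : ∀ u v : A →₀ ℕ, degA u = degA v → ¬ Conn u v →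
      ∃ u' v', Conn u u' ∧ Conn v v' ∧ R u' v') {u v : A →₀ ℕ} (h : degA u = degA v) : R u v := by
  induction hd : degA u using Nat.strong_induction_on generalizing u v with
  | _ d ih =>
    have hlt : ∀ w z : A →₀ ℕ, degA w = degA z → degA w < d → R w z :=
      fun w z hwz hw => ih _ hw hwz rfl
    by_cases hc : Conn u v
    · exact con_of_conn hpos (hd ▸ hlt) hc
    · obtain ⟨u', v', hu, hv, huv⟩ := hR u v h hc
      exact R.trans (con_of_conn hpos (hd ▸ hlt) hu)
        (R.trans huv (R.symm (con_of_conn hpos (h ▸ hd ▸ hlt) hv)))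

end Connectivity

/-! ## The universal Markov basis -/

section Markov

variable (K : Type*) [Field K] {A : Finset ℕ}

/-- If `u` and `v` were connected, relations of smaller degree would already give `x ^ u - x ^ v`.
Such relations follow from the other elements of `B`, so this binomial would be redundant. -/
lemma not_conn_of_mem_markov (hpos : ∀ a ∈ A, 0 < a) {B : Set (MvPolynomial A K)}
    (hB : IsMarkovBasis K A B) {u v : A →₀ ℕ} (hne : u ≠ v) (huv : binom K u v ∈ B) :
    ¬ Conn u v := by
  intro hc
  obtain ⟨⟨hbin, hspan⟩, hmin⟩ := hB
  set f := binom K u v with hf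
  set B' := B \ {f} with hB'
  let R : AddCon (A →₀ ℕ) := idealCon K (Ideal.span B')
  -- `Q` agrees with `R` strictly below the degree of `u` and records only the degree from there on,
  -- so it admits all of `B`, including `f`.
  let Q : AddCon (A →₀ ℕ) :=
    { r := fun w z => degA w = degA z ∧ (degA w < degA u → R w z)
      iseqv :=
        { refl := fun w => ⟨rfl, fun _ => R.refl _⟩
          symm := fun h => ⟨h.1.symm, fun h' => R.symm (h.2 (h.1 ▸ h'))⟩
          trans := fun h h' => ⟨h.1.trans h'.1, fun h'' => R.trans (h.2 h'') (h'.2 (h.1 ▸ h''))⟩ }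
      add' := fun {w x y z} h h' => ⟨by simp [h.1, h'.1], fun h'' => by
        rw [degA_add] at h''
        exact R.add (h.2 (by omega)) (h'.2 (by omega))⟩ }
  have hBQ : ∀ g ∈ B, ∃ w z, Q w z ∧ g = binom K w z := by
    intro g hg
    obtain ⟨w, z, hwz, rfl⟩ := hbin g hg
    have hd : degA w = degA z :=
      (binom_mem_toricIdeal K).1 (hspan ▸ Ideal.subset_span hg)
    refine ⟨w, z, ⟨hd, fun hlt => Ideal.subset_span ⟨hg, fun he => ?_⟩⟩, rfl⟩
    have huvd := hc.degA_eq
    rcases binom_inj K hne (hf ▸ (Set.mem_singleton_iff.1 he).symm) with ⟨rfl, rfl⟩ | ⟨rfl, rfl⟩ <;>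
      omega
  have hR : R u v := con_of_conn hpos (fun w z hwz hlt =>
    (con_of_mem_span K Q hBQ (hspan ▸ (binom_mem_toricIdeal K).2 hwz)).2 hlt) hc
  have hsp : Ideal.span B' = toricIdeal K A := by
    rw [← hspan]
    refine le_antisymm (Ideal.span_mono Set.sdiff_subset) (Ideal.span_le.2 fun g hg => ?_)
    by_cases he : g = f
    · exact he ▸ hR
    · exact Ideal.subset_span ⟨hg, he⟩
  exact (hmin ⟨fun g hg => hbin g hg.1, hsp⟩ Set.sdiff_subset huv).2 rfl

/-- A star in each fiber: a root `r` is joined to a representative `ρ` of every component but its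
own. The choices are bent so that `u` is the root of its fiber and `v` represents its component.
Minimality holds because only one edge of the star meets a given component other than that of the
root. -/
lemma exists_markov_of_not_conn (hpos : ∀ a ∈ A, 0 < a) {u v : A →₀ ℕ} (hd : degA u = degA v)
    (hc : ¬ Conn u v) : ∃ B, IsMarkovBasis K A B ∧ binom K u v ∈ B := by
  classical
  let s : Setoid (A →₀ ℕ) := ⟨Conn, Conn.refl, Conn.symm, Conn.trans⟩
  let ρ : (A →₀ ℕ) → (A →₀ ℕ) := fun w => if Conn v w then v else (Quotient.mk s w).out
  let r : ℕ → (A →₀ ℕ) := fun d =>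
    if d = degA u then u else if h : ∃ w : A →₀ ℕ, degA w = d then h.choose else 0
  have hρ : ∀ w, Conn w (ρ w) := fun w => by
    by_cases h : Conn v w
    · simpa [ρ, h] using h.symm
    · simp only [ρ, if_neg h]
      exact (Quotient.mk_out (s := s) w).symm
  have hρeq : ∀ w z, Conn w z → ρ w = ρ z := fun w z h => by
    have h1 : Conn v w ↔ Conn v z := ⟨fun h' => h'.trans h, fun h' => h'.trans h.symm⟩
    have h2 : Quotient.mk s w = Quotient.mk s z := Quotient.sound h
    simp only [ρ, h1, h2]
  have hr : ∀ w : A →₀ ℕ, degA (r (degA w)) = degA w := fun w => by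
    by_cases h : degA w = degA u
    · simp [r, h]
    · have h' : ∃ z : A →₀ ℕ, degA z = degA w := ⟨w, rfl⟩
      simp only [r, if_neg h, dif_pos h']
      exact h'.choose_spec
  let B : Set (MvPolynomial A K) :=
    {f | ∃ w, ¬ Conn (r (degA w)) w ∧ f = binom K (r (degA w)) (ρ w)}
  have hBspan : Ideal.span B = toricIdeal K A := by
    apply le_antisymm
    · refine Ideal.span_le.2 ?_
      rintro _ ⟨w, -, rfl⟩
      exact (binom_mem_toricIdeal K).2 ((hr w).trans (hρ w).degA_eq)
    · refine Ideal.span_le.2 ?_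
      rintro _ ⟨w, z, hwz, rfl⟩
      refine con_of_components (R := idealCon K (Ideal.span B)) hpos (fun p q hpq _ => ?_) hwz
      have key : ∀ p : A →₀ ℕ, ∃ p', Conn p p' ∧
          idealCon K (Ideal.span B) (r (degA p)) p' := fun p => by
        by_cases h : Conn (r (degA p)) p
        · exact ⟨_, h.symm, AddCon.refl _ _⟩
        · exact ⟨ρ p, hρ p, Ideal.subset_span ⟨p, h, rfl⟩⟩
      obtain ⟨p', hp, hp'⟩ := key p
      obtain ⟨q', hq, hq'⟩ := key q
      rw [← hpq] at hq'
      exact ⟨p', q', hp, hq, AddCon.trans _ (AddCon.symm _ hp') hq'⟩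
  have hru : r (degA v) = u := by simp [r, hd]
  refine ⟨B, ⟨⟨?_, hBspan⟩, ?_⟩, v, by rwa [hru], ?_⟩
  · rintro _ ⟨w, hw, rfl⟩
    exact ⟨_, _, fun h => hw (by rw [h]; exact (hρ w).symm), rfl⟩
  · rintro B' ⟨-, hB'⟩ hsub f hf
    obtain ⟨w, hw, rfl⟩ := hf
    by_contra hfB'
    -- Without its edge, the component of `w` is separated by no remaining binomial, hence by no
    -- binomial of the ideal.
    have hcc : compCon hpos w (r (degA w)) (ρ w) := by
      refine con_of_mem_span K _ (B := B') ?_ ?_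
      · intro g hg
        obtain ⟨z, hz, rfl⟩ := hsub hg
        refine ⟨_, _, ⟨(hr z).trans (hρ z).degA_eq, ?_, ?_⟩, rfl⟩
        · intro h
          have hdz := h.degA_eq
          rw [hr z] at hdz
          exact absurd (hdz ▸ h.symm) hw
        · intro h
          have h' : Conn w z := h.trans (hρ z).symm
          rw [← hρeq w z h', ← h'.degA_eq] at hg
          exact absurd hg hfB'
      · rw [hB']
        exact (binom_mem_toricIdeal K).2 ((hr w).trans (hρ w).degA_eq)
    exact hw (hcc.2.2 (hρ w)).symm
  · rw [hru]
    simp [ρ, Conn.refl]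

lemma mem_universalMarkovBasis (hpos : ∀ a ∈ A, 0 < a) {u v : A →₀ ℕ} (hne : u ≠ v) :
    binom K u v ∈ universalMarkovBasis K A ↔ degA u = degA v ∧ ¬ Conn u v := by
  refine ⟨fun ⟨B, hB, h⟩ => ⟨?_, not_conn_of_mem_markov K hpos hB hne h⟩,
    fun ⟨h, h'⟩ => exists_markov_of_not_conn K hpos h h'⟩
  exact (binom_mem_toricIdeal K).1 (hB.1.2 ▸ Ideal.subset_span h)

lemma exists_of_mem_universalMarkovBasis {f : MvPolynomial A K}
    (hf : f ∈ universalMarkovBasis K A) : ∃ u v : A →₀ ℕ, u ≠ v ∧ f = binom K u v := by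
  obtain ⟨B, hB, h⟩ := hf
  exact hB.1.1 f h

end Markov

/-! ## Primitive binomials and circuits -/

section Primitive

variable (K : Type*) [Field K] {A : Finset ℕ}

lemma isPrimitive_iff {u v : A →₀ ℕ} : IsPrimitive K u v ↔ u ≠ v ∧ degA u = degA v ∧
    ∀ w z : A →₀ ℕ, w ≠ z → degA w = degA z → w ≤ u → z ≤ v → w = u ∧ z = v := by
  simp only [IsPrimitive, binom_mem_toricIdeal]

lemma IsPrimitive.symm {u v : A →₀ ℕ} (h : IsPrimitive K u v) : IsPrimitive K v u := by
  rw [isPrimitive_iff] at h ⊢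
  exact ⟨h.1.symm, h.2.1.symm, fun w z hwz hd hw hz => (h.2.2 z w hwz.symm hd.symm hz hw).symm⟩

lemma IsPrimitive.disjoint {u v : A →₀ ℕ} (h : IsPrimitive K u v) (a : A) :
    u a = 0 ∨ v a = 0 := by
  rw [isPrimitive_iff] at h
  by_contra! hc
  have hu : Finsupp.single a 1 ≤ u := single_le_of_le (Nat.pos_of_ne_zero hc.1)
  have hv : Finsupp.single a 1 ≤ v := single_le_of_le (Nat.pos_of_ne_zero hc.2)
  have h1 := degA_sub hu
  have h2 := degA_sub hv
  have h3 := h.2.1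
  have := (h.2.2 (u - Finsupp.single a 1) (v - Finsupp.single a 1) (fun he => h.1 ?_) (by omega)
    tsub_le_self tsub_le_self).1
  · have := DFunLike.congr_fun this a
    simp at this
    omega
  · rw [← tsub_add_cancel_of_le hu, he, tsub_add_cancel_of_le hv]

/-- A smaller binomial `x ^ w - x ^ z` would give the links `u = w + (u - w)`, `z + (u - w)`, `z +
(v - z) = v`. -/
lemma isPrimitive_of_not_conn (hpos : ∀ a ∈ A, 0 < a) {u v : A →₀ ℕ} (hd : degA u = degA v)
    (hc : ¬ Conn u v) : IsPrimitive K u v := by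
  refine (isPrimitive_iff K).2 ⟨fun h => hc (h ▸ Conn.refl _), hd, fun w z hwz hdwz hw hz => ?_⟩
  by_cases hwu : w = u
  · exact ⟨hwu, eq_of_le_of_degA_eq hpos hz (by rw [← hdwz, hwu, hd])⟩
  exfalso
  have h1 : u - w ≠ 0 := fun h => hwu (le_antisymm hw (tsub_eq_zero_iff_le.1 h))
  have h2 : z ≠ 0 := by
    rintro rfl
    exact hwz ((degA_eq_zero hpos).1 (by simpa using hdwz))
  have h3 := degA_sub hw
  have h4 := degA_sub hz
  have l1 := linked_add_left hdwz h1
  have l2 := linked_add_left (show degA (u - w) = degA (v - z) by omega) h2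
  rw [add_comm w, tsub_add_cancel_of_le hw, add_comm z] at l1
  rw [tsub_add_cancel_of_le hz] at l2
  exact hc (l1.conn.trans l2.conn)

lemma universalMarkovBasis_subset_graverBasis (hpos : ∀ a ∈ A, 0 < a) :
    universalMarkovBasis K A ⊆ graverBasis K A := by
  intro f hf
  obtain ⟨u, v, hne, rfl⟩ := exists_of_mem_universalMarkovBasis K hf
  obtain ⟨hd, hc⟩ := (mem_universalMarkovBasis K hpos hne).1 hf
  exact ⟨u, v, isPrimitive_of_not_conn K hpos hd hc, rfl⟩

lemma eq_single_of_le_single {w : A →₀ ℕ} {i : A} {n : ℕ} (h : w ≤ Finsupp.single i n) :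
    w = Finsupp.single i (w i) := by
  classical
  ext a
  have := h a
  rw [Finsupp.single_apply] at this ⊢
  split_ifs at this ⊢ with e
  · rw [e]
  · omega

lemma dvd_of_mul_eq_mul {s t a b : ℕ} (ha : 0 < a) (h : s * a = t * b) :
    b / Nat.gcd a b ∣ s := by
  have h1 : Nat.lcm a b ∣ s * a := Nat.lcm_dvd (dvd_mul_left _ _) (h ▸ dvd_mul_left _ _)
  have h2 : b / Nat.gcd a b * a = Nat.lcm a b := by
    rw [Nat.lcm, mul_comm a, Nat.mul_div_right_comm (Nat.gcd_dvd_right a b)]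
  rw [← h2] at h1
  exact Nat.dvd_of_mul_dvd_mul_right ha h1

lemma div_gcd_mul (a b : ℕ) : b / Nat.gcd a b * a = Nat.lcm a b := by
  rw [Nat.lcm, mul_comm a, Nat.mul_div_right_comm (Nat.gcd_dvd_right a b)]

/-- The monomial `x_i ^ (a_j / gcd (a_i, a_j))` of the circuit on the variables `i` and `j`. -/
noncomputable def circ (i j : A) : A →₀ ℕ := Finsupp.single i ((j : ℕ) / Nat.gcd i j)

lemma degA_circ (i j : A) : degA (circ i j) = Nat.lcm i j := by
  rw [circ, degA_single, div_gcd_mul]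

lemma degA_circ_comm (i j : A) : degA (circ i j) = degA (circ j i) := by
  rw [degA_circ, degA_circ, Nat.lcm_comm]

lemma circ_pos (hpos : ∀ a ∈ A, 0 < a) (i j : A) : 0 < (j : ℕ) / Nat.gcd i j :=
  Nat.div_pos (Nat.le_of_dvd (hpos j j.2) (Nat.gcd_dvd_right _ _))
    (Nat.gcd_pos_of_pos_left _ (hpos i i.2))

lemma isPrimitive_circ (hpos : ∀ a ∈ A, 0 < a) {i j : A} (hij : i ≠ j) :
    IsPrimitive K (circ i j) (circ j i) := by
  rw [isPrimitive_iff]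
  refine ⟨fun h => ?_, degA_circ_comm i j, fun w z hwz hd hw hz => ?_⟩
  · have := DFunLike.congr_fun h i
    have h2 := circ_pos hpos i j
    simp only [circ, Finsupp.single_apply, if_true, if_neg (Ne.symm hij)] at this
    omega
  · have hw' := eq_single_of_le_single hw
    have hz' := eq_single_of_le_single hz
    have hw0 : 0 < w i := by
      by_contra! h0
      have hw0 : w = 0 := by rw [hw']; simpa using h0
      refine hwz (hw0.trans ((degA_eq_zero hpos).1 ?_).symm)
      rw [← hd, hw0, degA_zero]
    have heq : w i * i = z j * j := by
      rw [← degA_single, ← degA_single, ← hw', ← hz', hd]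
    have hle : w i ≤ (j : ℕ) / Nat.gcd i j := by simpa [circ] using hw i
    have hwi := Nat.le_of_dvd hw0 (dvd_of_mul_eq_mul (hpos i i.2) heq)
    have hwu : w = circ i j := by
      rw [hw', circ, le_antisymm hle hwi]
    exact ⟨hwu, eq_of_le_of_degA_eq hpos hz (by rw [← hd, hwu, degA_circ_comm])⟩

lemma eq_circ_of_isPrimitive (hpos : ∀ a ∈ A, 0 < a) {i j : A} {s t : ℕ}
    (h : IsPrimitive K (Finsupp.single i s) (Finsupp.single j t)) :
    i ≠ j ∧ Finsupp.single i s = circ i j ∧ Finsupp.single j t = circ j i := by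
  have hdis := h.disjoint
  rw [isPrimitive_iff] at h
  obtain ⟨hne, hd, hmin⟩ := h
  rw [degA_single, degA_single] at hd
  have hi := hpos i i.2
  have hj := hpos j j.2
  have hs : 0 < s := by
    rw [Nat.pos_iff_ne_zero]
    rintro rfl
    have : t = 0 := by
      rcases Nat.mul_eq_zero.1 (hd.symm.trans (Nat.zero_mul _)) with h | h <;> omega
    simp [this] at hne
  have ht : 0 < t := by
    rw [Nat.pos_iff_ne_zero]
    rintro rfl
    rcases Nat.mul_eq_zero.1 (hd.trans (Nat.zero_mul _)) with h | h <;> omega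
  have hij : i ≠ j := by
    rintro rfl
    have := hdis i
    simp at this
    omega
  have hp := (isPrimitive_iff K).1 (isPrimitive_circ K hpos hij)
  have h1 := Nat.le_of_dvd hs (dvd_of_mul_eq_mul hi hd)
  have h2 := Nat.le_of_dvd ht (dvd_of_mul_eq_mul hj hd.symm)
  have := hmin (circ i j) (circ j i) hp.1 hp.2.1 (single_le_of_le (by simpa using h1))
    (single_le_of_le (by simpa using h2))
  exact ⟨hij, this.1.symm, this.2.symm⟩

lemma eq_single_of_support_subset {w : A →₀ ℕ} {i : A} (h : w.support ⊆ {i}) :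
    w = Finsupp.single i (w i) := by
  classical
  ext a
  rw [Finsupp.single_apply]
  split_ifs with e
  · rw [e]
  · by_contra hc
    exact e (Finset.mem_singleton.1 (h (Finsupp.mem_support_iff.2 hc))).symm

lemma circ_support (hpos : ∀ a ∈ A, 0 < a) (i j : A) : (circ i j).support = {i} :=
  Finsupp.support_single _ (circ_pos hpos i j).ne'

lemma isCircuit_circ (hpos : ∀ a ∈ A, 0 < a) {i j : A} (hij : i ≠ j) :
    IsCircuit K (circ i j) (circ j i) := by
  classical
  have hp := (isPrimitive_iff K).1 (isPrimitive_circ K hpos hij)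
  refine ⟨hp.1, (binom_mem_toricIdeal K).2 hp.2.1, ?_, ?_, ?_⟩
  · rw [circ_support hpos, circ_support hpos]
    simpa using hij
  · have hi : (circ i j + circ j i) i = (j : ℕ) / Nat.gcd i j := by
      simp [circ, hij.symm]
    have hj : (circ i j + circ j i) j = (i : ℕ) / Nat.gcd i j := by
      simp [circ, hij, Nat.gcd_comm]
    have hg := Nat.coprime_div_gcd_div_gcd (m := (i : ℕ)) (n := j)
      (Nat.gcd_pos_of_pos_left _ (hpos i i.2))
    have hmem : ∀ a, a = i ∨ a = j → a ∈ (circ i j + circ j i).support := by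
      rintro a (rfl | rfl) <;> rw [Finsupp.mem_support_iff]
      · rw [hi]; exact (circ_pos hpos _ _).ne'
      · rw [hj, Nat.gcd_comm]; exact (circ_pos hpos _ _).ne'
    refine Nat.eq_one_of_dvd_coprimes hg ?_ ?_
    · exact hj ▸ Finset.gcd_dvd (hmem j (Or.inr rfl))
    · exact hi ▸ Finset.gcd_dvd (hmem i (Or.inl rfl))
  · intro w z hwz hd hss
    rw [binom_mem_toricIdeal] at hd
    rw [circ_support hpos, circ_support hpos] at hss
    have key : ∀ k l : A, ({k} ∪ {l} : Finset A) = {i} ∪ {j} → k ∉ w.support ∪ z.support →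
        False := by
      intro k l hkl hk
      rw [← hkl] at hss
      have hsub : w.support ∪ z.support ⊆ {l} := by
        intro a ha
        have := hss.1 ha
        simp only [Finset.mem_union, Finset.mem_singleton] at this ⊢
        rcases this with rfl | h
        · exact absurd ha hk
        · exact h
      have h1 := eq_single_of_support_subset (Finset.union_subset_left hsub)
      have h2 := eq_single_of_support_subset (Finset.union_subset_right hsub)
      have h3 := hd
      rw [h1, h2, degA_single, degA_single] at h3
      exact hwz (by rw [h1, h2, Nat.eq_of_mul_eq_mul_right (hpos l l.2) h3])
    obtain ⟨k, hk, hk'⟩ := Finset.exists_of_ssubset hss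
    simp only [Finset.mem_union, Finset.mem_singleton] at hk
    rcases hk with rfl | rfl
    · exact key k j rfl hk'
    · exact key k i (Finset.union_comm _ _) hk'

/-- Positivity of the weights makes both monomials nontrivial. With `i` and `j` in their supports,
the binomial on `i` and `j` forces the whole support to be `{i, j}`, and coprimality of the
exponents excludes proper powers. -/
lemma isCircuit_iff (hpos : ∀ a ∈ A, 0 < a) {u v : A →₀ ℕ} :
    IsCircuit K u v ↔ ∃ i j, i ≠ j ∧ u = circ i j ∧ v = circ j i := by
  classical
  constructor
  · rintro ⟨hne, hd, hdis, hgcd, hmin⟩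
    rw [binom_mem_toricIdeal] at hd
    have hu : u ≠ 0 := by
      rintro rfl
      exact hne ((degA_eq_zero hpos).1 (by rw [← hd, degA_zero])).symm
    have hv : v ≠ 0 := by
      rintro rfl
      exact hne ((degA_eq_zero hpos).1 (by rw [hd, degA_zero]))
    obtain ⟨i, hi⟩ := Finsupp.support_nonempty_iff.2 hu
    obtain ⟨j, hj⟩ := Finsupp.support_nonempty_iff.2 hv
    have hij : i ≠ j := fun h => Finset.disjoint_left.1 hdis hi (h ▸ hj)
    have hp := (isPrimitive_iff K).1 (isPrimitive_circ K hpos hij)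
    have := hmin (circ i j) (circ j i) hp.1 ((binom_mem_toricIdeal K).2 hp.2.1)
    rw [circ_support hpos, circ_support hpos, Finset.ssubset_iff_subset_ne, not_and_not_right] at this
    have hs := this (by
      intro a
      simp only [Finset.mem_union, Finset.mem_singleton]
      rintro (rfl | rfl)
      exacts [Or.inl hi, Or.inr hj])
    have hus : u.support ⊆ {i} := by
      intro a ha
      have h1 : a ∈ ({i} ∪ {j} : Finset A) := hs ▸ Finset.mem_union_left _ ha
      simp only [Finset.mem_union, Finset.mem_singleton] at h1 ⊢
      rcases h1 with h1 | rfl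
      · exact h1
      · exact absurd hj (Finset.disjoint_left.1 hdis ha)
    have hvs : v.support ⊆ {j} := by
      intro a ha
      have h1 : a ∈ ({i} ∪ {j} : Finset A) := hs ▸ Finset.mem_union_right _ ha
      simp only [Finset.mem_union, Finset.mem_singleton] at h1 ⊢
      rcases h1 with rfl | h1
      · exact absurd ha (Finset.disjoint_left.1 hdis hi)
      · exact h1
    have hu' := eq_single_of_support_subset hus
    have hv' := eq_single_of_support_subset hvs
    set s := u i
    set t := v j
    have heq : s * i = t * j := by rw [← degA_single, ← degA_single, ← hu', ← hv', hd]
    obtain ⟨k, hk⟩ := dvd_of_mul_eq_mul (hpos i i.2) heq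
    have hk2 : t = (i : ℕ) / Nat.gcd j i * k := by
      have h1 : (j : ℕ) / Nat.gcd i j * i = i / Nat.gcd j i * j := by
        rw [div_gcd_mul, div_gcd_mul, Nat.lcm_comm]
      refine Nat.eq_of_mul_eq_mul_right (hpos j j.2) ?_
      rw [← heq, hk, mul_right_comm, h1, mul_right_comm]
    have hk1 : k = 1 := by
      rw [← Nat.dvd_one, ← hgcd]
      refine Finset.dvd_gcd fun a _ => ?_
      rw [hu', hv', Finsupp.add_apply]
      refine dvd_add ?_ ?_
      · rw [Finsupp.single_apply]
        split_ifs
        · exact hk ▸ dvd_mul_left _ _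
        · exact dvd_zero _
      · rw [Finsupp.single_apply]
        split_ifs
        · exact hk2 ▸ dvd_mul_left _ _
        · exact dvd_zero _
    rw [hk1, mul_one] at hk hk2
    exact ⟨i, j, hij, by rw [hu', hk, circ], by rw [hv', hk2, circ]⟩
  · rintro ⟨i, j, hij, rfl, rfl⟩
    exact isCircuit_circ K hpos hij

lemma mem_circuits (hpos : ∀ a ∈ A, 0 < a) {f : MvPolynomial A K} :
    f ∈ circuits K A ↔ ∃ i j : A, i ≠ j ∧ f = binom K (circ i j) (circ j i) := by
  constructor
  · rintro ⟨u, v, h, rfl⟩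
    obtain ⟨i, j, hij, rfl, rfl⟩ := (isCircuit_iff K hpos).1 h
    exact ⟨i, j, hij, rfl⟩
  · rintro ⟨i, j, hij, rfl⟩
    exact ⟨_, _, isCircuit_circ K hpos hij, rfl⟩

lemma circuits_subset_graverBasis (hpos : ∀ a ∈ A, 0 < a) : circuits K A ⊆ graverBasis K A := by
  intro f hf
  obtain ⟨i, j, hij, rfl⟩ := (mem_circuits K hpos).1 hf
  exact ⟨_, _, isPrimitive_circ K hpos hij, rfl⟩

lemma F1_subset_F4 : F1 K ⊆ F4 K := by
  rintro S ⟨A, hA, h⟩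
  exact ⟨A, hA, (circuits_subset_graverBasis K hA.1).trans (ge_of_eq h)⟩

end Primitive

/-! ## Free arrangements -/

section Arrangement

/-- A linear order in which the elements of `T` come last, preceded by `k`. -/
lemma exists_linearOrder_above {α : Type*} [Finite α] (T : Finset α) (k : α) :
    ∃ r : LinearOrder α, (∀ a ∈ T, ∀ b, b ∉ T → r.lt b a) ∧ ∀ b, b ∉ T → b ≠ k → r.lt b k := by
  classical
  obtain ⟨n, ⟨f⟩⟩ := Finite.exists_equiv_fin α
  let g : α → ℕ ×ₗ Fin n := fun a => toLex (if a ∈ T then 2 else if a = k then 1 else 0, f a)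
  have hg : Function.Injective g := fun a b h => by
    have : (ofLex (g a)).2 = (ofLex (g b)).2 := by rw [h]
    exact f.injective this
  refine ⟨LinearOrder.lift' g hg, fun a ha b hb => ?_, fun b hb hbk => ?_⟩
  · change g b < g a
    rw [Prod.Lex.lt_iff]
    left
    simp only [g, ofLex_toLex, if_pos ha, if_neg hb]
    split_ifs <;> omega
  · change g b < g k
    rw [Prod.Lex.lt_iff]
    left
    simp only [g, ofLex_toLex, if_neg hb, if_neg hbk, if_true]
    split_ifs <;> omega

lemma exists_arrangement {α : Type*} [Fintype α] {n : ℕ} (hn : Fintype.card α = n) {T : Finset α}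
    {k : α} (hk : k ∉ T) : ∃ (e : Fin n ≃ α) (m : Fin n), e m = k ∧ ∀ i, e i ∈ T ↔ m < i := by
  obtain ⟨r, h1, h2⟩ := exists_linearOrder_above T k
  let o := monoEquivOfFin α hn
  refine ⟨o.toEquiv, o.symm k, o.apply_symm_apply k, fun i => ?_⟩
  rw [OrderIso.symm_apply_lt]
  refine ⟨fun h => h1 _ h _ hk, fun h => ?_⟩
  by_contra hc
  exact lt_asymm h (h2 _ hc h.ne')

variable {A : Finset ℕ}

lemma mem_closure_image_iff {T : Finset A} {n : ℕ} :
    n ∈ AddSubmonoid.closure ((fun a : A => (a : ℕ)) '' (T : Set A)) ↔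
      ∃ w : A →₀ ℕ, w.support ⊆ T ∧ degA w = n := by
  classical
  constructor
  · intro h
    induction h using AddSubmonoid.closure_induction with
    | mem x hx =>
      obtain ⟨a, ha, rfl⟩ := hx
      exact ⟨Finsupp.single a 1, Finsupp.support_single_subset.trans (by simpa using ha), by simp⟩
    | zero => exact ⟨0, by simp, by simp⟩
    | add x y _ _ hx hy =>
      obtain ⟨u, hu, rfl⟩ := hx
      obtain ⟨v, hv, rfl⟩ := hy
      exact ⟨u + v, Finsupp.support_add.trans (Finset.union_subset hu hv), by simp⟩
  · rintro ⟨w, hw, rfl⟩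
    refine AddSubmonoid.sum_mem _ fun a _ => ?_
    by_cases ha : a ∈ w.support
    · rw [← smul_eq_mul]
      exact nsmul_mem (AddSubmonoid.subset_closure (Set.mem_image_of_mem _ (hw ha))) _
    · simp [Finsupp.notMem_support_iff.1 ha]

/-- The multiple `lcm (k, gcd T)` of `k` is the degree of a monomial in the variables of `T`. -/
def FreeStep (T : Finset A) (k : A) : Prop :=
  ∃ w : A →₀ ℕ, w.support ⊆ T ∧ degA w = Nat.lcm k (T.gcd fun a => (a : ℕ))

lemma freeStep_of_universallyFree (h : UniversallyFree A) {T : Finset A} {k : A} (hk : k ∉ T) :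
    FreeStep T k := by
  classical
  rcases T.eq_empty_or_nonempty with rfl | ⟨t, ht⟩
  -- For empty `T` the gcd is `0`, so the required degree is `0`.
  · exact ⟨0, by simp, by simp⟩
  obtain ⟨e, m, hm, hT⟩ := exists_arrangement (n := A.card) (by simp) hk
  have hI : T = (Finset.Ioi m).image e := by
    ext a
    simp only [Finset.mem_image, Finset.mem_Ioi]
    refine ⟨fun ha => ⟨e.symm a, (hT _).1 (by simpa using ha), by simp⟩, ?_⟩
    rintro ⟨i, hi, rfl⟩
    exact (hT i).2 hi
  have hlt : (m : ℕ) + 1 < A.card := by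
    have h1 : m < e.symm t := (hT _).1 (by simpa using ht)
    have h2 := (e.symm t).2
    have h3 : (m : ℕ) < e.symm t := h1
    omega
  have := h e m hlt
  beta_reduce at this
  rw [hm] at this
  rw [FreeStep, ← mem_closure_image_iff]
  convert this using 2
  · rw [hI, Finset.coe_image, Finset.coe_Ioi, Set.image_image]
  · rw [hI, Finset.gcd_image]
    rfl

lemma universallyFree_of_freeStep (h : ∀ (T : Finset A) (k : A), T.Nonempty → k ∉ T →
    FreeStep T k) : UniversallyFree A := by
  classical
  intro e m hm
  have := h ((Finset.Ioi m).image e) (e m) ?_ ?_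
  · rw [FreeStep, ← mem_closure_image_iff, Finset.gcd_image, Finset.coe_image, Finset.coe_Ioi,
      Set.image_image] at this
    exact this
  · exact ⟨e ⟨m + 1, hm⟩, Finset.mem_image_of_mem _ (Finset.mem_Ioi.2 (Nat.lt_succ_self m))⟩
  · simp

end Arrangement

/-! ## Adjoining a variable -/

section Adjoin

variable {A : Finset ℕ}

lemma degA_erase (u : A →₀ ℕ) (k : A) : u k * k + degA (u.erase k) = degA u := by
  rw [← degA_single, ← degA_add, Finsupp.single_add_erase]

lemma support_erase_subset [DecidableEq A] {u : A →₀ ℕ} {k : A} {T : Finset A}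
    (h : u.support ⊆ insert k T) : (u.erase k).support ⊆ T := by
  intro a ha
  rw [Finsupp.support_erase, Finset.mem_erase] at ha
  exact (Finset.mem_insert.1 (h ha.2)).resolve_left ha.1

lemma gcd_dvd_degA {u : A →₀ ℕ} {T : Finset A} (h : u.support ⊆ T) :
    (T.gcd fun a => (a : ℕ)) ∣ degA u :=
  dvd_degA fun _ ha => (Finset.gcd_dvd (h ha)).mul_left _

/-- The rule reduces the exponent of `k` modulo `c = d / gcd (k, d)`, where `d = gcd T`. Equal
degrees make `p k * k` and `q k * k` congruent modulo `d`, so the remainders coincide and the parts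
in `T` have equal degree. -/
lemma con_insert [DecidableEq A] (hpos : ∀ a ∈ A, 0 < a) {R : AddCon (A →₀ ℕ)} {T : Finset A}
    {k : A} {w : A →₀ ℕ}
    (hR : ∀ p q : A →₀ ℕ, p.support ⊆ T → q.support ⊆ T → degA p = degA q → R p q)
    (hw : w.support ⊆ T) (hwd : degA w = Nat.lcm k (T.gcd fun a => (a : ℕ)))
    (hrule : R (Finsupp.single k ((T.gcd fun a => (a : ℕ)) /
      Nat.gcd k (T.gcd fun a => (a : ℕ)))) w) {p q : A →₀ ℕ}
    (hp : p.support ⊆ insert k T) (hq : q.support ⊆ insert k T) (hpq : degA p = degA q) :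
    R p q := by
  set d := T.gcd fun a => (a : ℕ) with hd
  set c := d / Nat.gcd k d with hc
  have hck : c * k = degA w := by rw [hwd, hc, div_gcd_mul]
  have hsplit : ∀ u : A →₀ ℕ,
      R u (Finsupp.single k (u k % c) + ((u k / c) • w + u.erase k)) := fun u => by
    have h1 : u = Finsupp.single k (u k % c) +
        ((u k / c) • Finsupp.single k c + u.erase k) := by
      conv_lhs => rw [← Finsupp.single_add_erase k u]
      rw [← add_assoc, Finsupp.smul_single, ← Finsupp.single_add, smul_eq_mul, mul_comm (u k / c),
        Nat.mod_add_div]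
    conv_lhs => rw [h1]
    exact R.add (R.refl _) (R.add (R.nsmul _ hrule) (R.refl _))
  have hdeg : ∀ u : A →₀ ℕ, degA u = u k % c * k + degA ((u k / c) • w + u.erase k) := fun u => by
    rw [← degA_erase u k, degA_add, degA_nsmul, ← hck, ← mul_assoc, ← add_assoc, ← add_mul,
      mul_comm (u k / c), Nat.mod_add_div]
  have hmod : p k % c = q k % c := by
    have hk := hpos k k.2
    have h1 : p k * k ≡ q k * k [MOD d] := by
      have hp' := (Nat.modEq_zero_iff_dvd.2 (gcd_dvd_degA (support_erase_subset hp))).add_left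
        (p k * k)
      have hq' := (Nat.modEq_zero_iff_dvd.2 (gcd_dvd_degA (support_erase_subset hq))).add_left
        (q k * k)
      rw [degA_erase] at hp' hq'
      rw [← hpq] at hq'
      exact hp'.symm.trans hq'
    rcases Nat.eq_zero_or_pos d with h0 | h0
    -- For `d = 0`, that is `T` empty, congruence is equality.
    · rw [h0, Nat.modEq_zero_iff] at h1
      rw [Nat.eq_of_mul_eq_mul_right hk h1]
    · have := Nat.ModEq.cancel_right_div_gcd h0 h1
      rwa [Nat.gcd_comm] at this
  have hsupp : ∀ u : A →₀ ℕ, u.support ⊆ insert k T →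
      ((u k / c) • w + u.erase k).support ⊆ T := fun u hu =>
    Finsupp.support_add.trans (Finset.union_subset (Finsupp.support_smul.trans hw)
      (support_erase_subset hu))
  refine R.trans (hsplit p) (R.trans ?_ (R.symm (hsplit q)))
  rw [hmod]
  refine R.add (R.refl _) (hR _ _ (hsupp p hp) (hsupp q hq) ?_)
  have h1 := hdeg p
  have h2 := hdeg q
  rw [hmod] at h1
  omega

end Adjoin

/-! ## Universally free semigroups -/

section UniversallyFree

variable {A : Finset ℕ}

/-- Chains of linked vectors of degree `b` in the variables of `T`. -/
def ConnIn (T : Finset A) (b : ℕ) : (A →₀ ℕ) → (A →₀ ℕ) → Prop :=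
  Relation.ReflTransGen fun u v => Linked u v ∧ u.support ⊆ T ∧ v.support ⊆ T ∧ degA u = b

/-- Replacing `x_k ^ c` by `x ^ w` maps chains to chains. As `d ∣ b`, the exponents of `k` are
multiples of `c`, so the replacement is complete and preserves the degree. A link through `k`
becomes a link through a variable of `w`. -/
lemma ConnIn.of_insert [DecidableEq A] (hpos : ∀ a ∈ A, 0 < a) {T : Finset A} {k : A} {b : ℕ}
    {w u v : A →₀ ℕ} (hw : w.support ⊆ T)
    (hwd : degA w = Nat.lcm k (T.gcd fun a => (a : ℕ))) (hT : T.Nonempty)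
    (hb : (T.gcd fun a => (a : ℕ)) ∣ b) (hu : u k = 0) (hv : v k = 0)
    (h : ConnIn (insert k T) b u v) : ConnIn T b u v := by
  set d := T.gcd fun a => (a : ℕ) with hd
  set c := d / Nat.gcd k d with hc
  have hck : c * k = degA w := by rw [hwd, hc, div_gcd_mul]
  have hd0 : 0 < d := by
    obtain ⟨t, ht⟩ := hT
    exact Nat.pos_of_dvd_of_pos (Finset.gcd_dvd ht) (hpos t t.2)
  have hw0 : w ≠ 0 := by
    rintro rfl
    have := Nat.lcm_pos (hpos k k.2) hd0
    rw [degA_zero] at hwd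
    omega
  let f : (A →₀ ℕ) → (A →₀ ℕ) := fun p => (p k / c) • w + p.erase k
  have hf0 : ∀ p : A →₀ ℕ, p k = 0 → f p = p := fun p hp => by
    simp only [f, hp, Nat.zero_div, zero_smul, zero_add]
    exact Finsupp.erase_of_notMem_support (by simpa using hp)
  have hfc : ∀ p : A →₀ ℕ, p.support ⊆ insert k T → degA p = b → p k / c * c = p k :=
    fun p hp hpb => by
    refine Nat.div_mul_cancel ?_
    have h1 : d ∣ p k * k := by
      rw [← hpb, ← degA_erase p k] at hb
      exact (Nat.dvd_add_left (gcd_dvd_degA (support_erase_subset hp))).1 hb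
    have h2 := Nat.lcm_dvd (dvd_mul_left (k : ℕ) (p k)) h1
    rw [← div_gcd_mul] at h2
    exact Nat.dvd_of_mul_dvd_mul_right (hpos k k.2) h2
  have hfd : ∀ p : A →₀ ℕ, p.support ⊆ insert k T → degA p = b → degA (f p) = b :=
    fun p hp hpb => by
    rw [degA_add, degA_nsmul, ← hck, ← mul_assoc, hfc p hp hpb, degA_erase, hpb]
  have hfs : ∀ p : A →₀ ℕ, p.support ⊆ insert k T → (f p).support ⊆ T := fun p hp =>
    Finsupp.support_add.trans (Finset.union_subset (Finsupp.support_smul.trans hw)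
      (support_erase_subset hp))
  rw [← hf0 u hu, ← hf0 v hv]
  refine Relation.ReflTransGen.lift f ?_ _ _ h
  rintro p q ⟨⟨hpq, a, ha, ha'⟩, hp, hq, hpb⟩
  have hqb := hpq ▸ hpb
  refine ⟨⟨(hfd p hp hpb).trans (hfd q hq hqb).symm, ?_⟩, hfs p hp, hfs q hq, hfd p hp hpb⟩
  by_cases hak : a = k
  · subst hak
    obtain ⟨a', ha'w⟩ := exists_pos_of_ne_zero hw0
    have key : ∀ p : A →₀ ℕ, 0 < p a → p a / c * c = p a → 0 < f p a' := fun p h1 h2 => by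
      have : 0 < p a / c := Nat.pos_of_ne_zero fun h => by rw [h] at h2; omega
      simp only [f, Finsupp.add_apply, Finsupp.smul_apply, smul_eq_mul]
      have := Nat.mul_pos this ha'w
      omega
    exact ⟨a', key p ha (hfc p hp hpb), key q ha' (hfc q hq hqb)⟩
  · refine ⟨a, ?_, ?_⟩ <;> simp [f, Finsupp.erase_ne hak] <;> omega

/-- In the variables `i` and `j` alone, a monomial of degree `lcm (a_i, a_j)` containing `x_i` must
be `circ i j`. The other variables are adjoined one at a time: any chain using the new one can be
pushed back by `ConnIn.of_insert`. -/
lemma not_conn_circ (hpos : ∀ a ∈ A, 0 < a) (hA : UniversallyFree A) {i j : A} (hij : i ≠ j) :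
    ¬ Conn (circ i j) (circ j i) := by
  classical
  set b := Nat.lcm i j
  have base : ¬ ConnIn {i, j} b (circ i j) (circ j i) := by
    have key : ∀ v, ConnIn {i, j} b (circ i j) v → v = circ i j := by
      intro v h
      induction h with
      | refl => rfl
      | @tail x y _ hxy ih =>
        obtain ⟨⟨hd, a, ha, ha'⟩, -, hy, hb⟩ := hxy
        subst ih
        have hai : a = i := by
          by_contra h
          simp [circ, Ne.symm h] at ha
        subst hai
        have h1 : (j : ℕ) ∣ degA (y.erase a) := by
          have := gcd_dvd_degA (support_erase_subset (u := y) (k := a) (T := {j}) hy)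
          simpa using this
        have h2 : (j : ℕ) ∣ y a * a := by
          refine (Nat.dvd_add_left h1).1 ?_
          rw [degA_erase, ← hd, hb]
          exact Nat.dvd_lcm_right _ _
        have h3 := Nat.lcm_dvd (dvd_mul_left (a : ℕ) (y a)) h2
        rw [← div_gcd_mul] at h3
        have h4 := Nat.le_of_dvd ha' (Nat.dvd_of_mul_dvd_mul_right (hpos a a.2) h3)
        exact (eq_of_le_of_degA_eq hpos (single_le_of_le h4) hd).symm
    intro h
    exact (isPrimitive_iff ℚ).1 (isPrimitive_circ ℚ hpos hij) |>.1 (key _ h).symm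
  have step : ∀ T : Finset A, ¬ ConnIn (T ∪ {i, j}) b (circ i j) (circ j i) := by
    intro T
    induction T using Finset.induction_on with
    | empty => simpa using base
    | insert k T _ ih =>
      rw [Finset.insert_union]
      by_cases hk : k ∈ T ∪ {i, j}
      · rwa [Finset.insert_eq_of_mem hk]
      · obtain ⟨w, hw, hwd⟩ := freeStep_of_universallyFree hA hk
        have hi : i ∈ T ∪ {i, j} := by simp
        have hj : j ∈ T ∪ {i, j} := by simp
        refine fun h => ih (h.of_insert hpos hw hwd ⟨i, hi⟩ ?_ ?_ ?_)
        · exact (Finset.gcd_dvd hi).trans (Nat.dvd_lcm_left _ _)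
        · exact Finsupp.single_eq_of_ne fun e => hk (e ▸ hi)
        · exact Finsupp.single_eq_of_ne fun e => hk (e ▸ hj)
  intro h
  refine step Finset.univ ?_
  have : ∀ v, Conn (circ i j) v → ConnIn (Finset.univ ∪ {i, j}) b (circ i j) v := by
    intro v h
    induction h with
    | refl => exact Relation.ReflTransGen.refl
    | tail h1 h2 ih =>
      refine Relation.ReflTransGen.tail ih ⟨h2, ?_, ?_, ?_⟩
      · intro a _; simp
      · intro a _; simp
      · rw [← Conn.degA_eq h1, degA_circ]
  exact this _ h

/-- If the component of `p` contains no pure power, every rule used respects it. Adjoining first the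
variables absent from the component and then those present, all equalities of degree respect it, so
it is the whole fiber, contrary to `q`. -/
lemma exists_conn_single (hpos : ∀ a ∈ A, 0 < a) (hA : UniversallyFree A) {p q : A →₀ ℕ}
    (hd : degA p = degA q) (hc : ¬ Conn p q) : ∃ i n, Conn p (Finsupp.single i n) := by
  classical
  by_contra! hno
  have hb : degA p ≠ 0 := fun h => by
    refine hc ?_
    have hq : q = 0 := (degA_eq_zero hpos).1 (hd ▸ h)
    rw [(degA_eq_zero hpos).1 h, hq]
    exact Conn.refl _
  let S : Finset A := Finset.univ.filter fun a => ∃ x, Conn p x ∧ 0 < x a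
  have hS : ∀ a, a ∈ S ↔ ∃ x, Conn p x ∧ 0 < x a := fun a => by simp [S]
  have rule : ∀ (T : Finset A) (k : A), k ∉ T → (Disjoint T S ∨ k ∈ S) →
      (∀ u v : A →₀ ℕ, u.support ⊆ T → v.support ⊆ T → degA u = degA v → compCon hpos p u v) →
      ∀ u v : A →₀ ℕ, u.support ⊆ insert k T → v.support ⊆ insert k T → degA u = degA v →
        compCon hpos p u v := by
    intro T k hk hTk hT u v hu hv huv
    obtain ⟨w, hw, hwd⟩ := freeStep_of_universallyFree hA hk
    refine con_insert hpos hT hw hwd ⟨?_, ?_⟩ hu hv huv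
    · rw [degA_single, div_gcd_mul, hwd]
    · refine iff_of_false (hno _ _) fun hpw => ?_
      have hwb := hpw.degA_eq
      -- Suppose `w` lies in the component. If `T` avoids its variables this is absurd; if `k`
      -- occurs in it, the power of `x_k` is linked to it.
      rcases hTk with hTk | hk'
      · have hw0 : w ≠ 0 := by
          rintro rfl
          exact hb (by rw [hwb, degA_zero])
        obtain ⟨a, ha⟩ := exists_pos_of_ne_zero hw0
        exact Finset.disjoint_left.1 hTk (hw (Finsupp.mem_support_iff.2 ha.ne'))
          ((hS a).2 ⟨w, hpw, ha⟩)
      · obtain ⟨x, hx, hxk⟩ := (hS k).1 hk'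
        set c := (T.gcd fun a => (a : ℕ)) / Nat.gcd k (T.gcd fun a => (a : ℕ)) with hcdef
        have hcd : degA (Finsupp.single k c) = degA p := by
          rw [degA_single, hcdef, div_gcd_mul, ← hwd, hwb]
        refine hno k c (hx.trans (Linked.conn ⟨?_, k, hxk, ?_⟩))
        · rw [hcd, hx.degA_eq]
        · rw [Finsupp.single_eq_same, Nat.pos_iff_ne_zero]
          intro h0
          rw [h0] at hcd
          simp at hcd
          exact hb hcd.symm
  have phase1 : ∀ T : Finset A, Disjoint T S → ∀ u v : A →₀ ℕ, u.support ⊆ T → v.support ⊆ T →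
      degA u = degA v → compCon hpos p u v := by
    intro T
    induction T using Finset.induction_on with
    | empty =>
      intro _ u v hu hv _
      rw [Finset.subset_empty, Finsupp.support_eq_empty] at hu hv
      rw [hu, hv]
      exact AddCon.refl _ _
    | insert k T hk ih =>
      intro hTS
      rw [Finset.disjoint_insert_left] at hTS
      exact rule T k hk (Or.inl hTS.2) (ih hTS.2)
  have phase2 : ∀ T : Finset A, T ⊆ S → ∀ u v : A →₀ ℕ, u.support ⊆ T ∪ Sᶜ →
      v.support ⊆ T ∪ Sᶜ → degA u = degA v → compCon hpos p u v := by
    intro T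
    induction T using Finset.induction_on with
    | empty =>
      intro _
      rw [Finset.empty_union]
      exact phase1 _ disjoint_compl_left
    | insert k T hk ih =>
      intro hTS
      have hkS := hTS (Finset.mem_insert_self k T)
      rw [Finset.insert_union]
      refine rule _ k ?_ (Or.inr hkS) (ih ((Finset.subset_insert k T).trans hTS))
      simp [hk, hkS]
  have hall : ∀ u : A →₀ ℕ, u.support ⊆ S ∪ Sᶜ := fun u => by
    rw [Finset.union_compl]
    exact Finset.subset_univ _
  have := phase2 S subset_rfl p q (hall p) (hall q) hd
  exact hc (this.2.1 (Conn.refl p))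

variable (K : Type*) [Field K]

lemma F3_subset_F4 : F3 ⊆ F4 K := by
  rintro S ⟨A, hA, h⟩
  refine ⟨A, hA, fun f hf => ?_⟩
  obtain ⟨i, j, hij, rfl⟩ := (mem_circuits K hA.1).1 hf
  rw [mem_universalMarkovBasis K hA.1 (isPrimitive_circ K hA.1 hij).1]
  exact ⟨degA_circ_comm i j, not_conn_circ hA.1 h hij⟩

lemma circuits_subset_toricIdeal (hpos : ∀ a ∈ A, 0 < a) :
    circuits K A ⊆ (toricIdeal K A : Set (MvPolynomial A K)) := by
  intro f hf
  obtain ⟨i, j, _, rfl⟩ := (mem_circuits K hpos).1 hf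
  exact (binom_mem_toricIdeal K).2 (degA_circ_comm i j)

/-- The toric ideal is generated by its circuits if the congruence of the circuits contains
all pairs of vectors of equal degree. -/
lemma toricIdeal_eq_span_circuits (hpos : ∀ a ∈ A, 0 < a)
    (h : ∀ u v : A →₀ ℕ, degA u = degA v → idealCon K (Ideal.span (circuits K A)) u v) :
    toricIdeal K A = Ideal.span (circuits K A) := by
  refine le_antisymm (Ideal.span_le.2 ?_)
    (Ideal.span_le.2 (circuits_subset_toricIdeal K hpos))
  rintro _ ⟨u, v, huv, rfl⟩
  exact h u v huv

lemma F3_subset_F5 : F3 ⊆ F5 K := by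
  rintro S ⟨A, hA, h⟩
  refine ⟨A, hA, toricIdeal_eq_span_circuits K hA.1 fun u v => con_of_components hA.1 ?_⟩
  intro p q hpq hc
  obtain ⟨i, s, hi⟩ := exists_conn_single hA.1 h hpq hc
  obtain ⟨j, t, hj⟩ := exists_conn_single hA.1 h hpq.symm fun h => hc h.symm
  refine ⟨_, _, hi, hj, ?_⟩
  have hst : s * i = t * j := by
    rw [← degA_single, ← degA_single, ← hi.degA_eq, ← hj.degA_eq, hpq]
  by_cases hij : i = j
  · subst hij
    rw [Nat.eq_of_mul_eq_mul_right (hA.1 i i.2) hst]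
    exact AddCon.refl _ _
  -- The two pure powers are `n`-th powers of the two monomials of the circuit on `i` and `j`.
  · obtain ⟨n, hn⟩ := dvd_of_mul_eq_mul (hA.1 i i.2) hst
    have hn' : t = (i : ℕ) / Nat.gcd j i * n := by
      refine Nat.eq_of_mul_eq_mul_right (hA.1 j j.2) ?_
      rw [← hst, hn, mul_right_comm, div_gcd_mul, mul_right_comm, div_gcd_mul, Nat.lcm_comm]
    have hcirc : idealCon K (Ideal.span (circuits K A)) (circ i j) (circ j i) :=
      Ideal.subset_span ((mem_circuits K hA.1).2 ⟨i, j, hij, rfl⟩)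
    have := AddCon.nsmul _ n hcirc
    rw [circ, circ, Finsupp.smul_single, Finsupp.smul_single, smul_eq_mul, smul_eq_mul, mul_comm n,
      mul_comm n, ← hn, ← hn'] at this
    exact this

end UniversallyFree

/-! ## The universal Gröbner basis -/

section Groebner

/-- An elimination order for the variables in `T`, in which `k` comes next. -/
lemma exists_eliminationOrder {α : Type} [Finite α] {T : Finset α} {k : α} (hk : k ∉ T) :
    ∃ m : MonomialOrder.{0, 0} α, ∀ u w : α →₀ ℕ, m.toSyn w ≤ m.toSyn u →
      ((∀ a, a ∉ T → u a = 0) → ∀ a, a ∉ T → w a = 0) ∧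
      ((∀ a, a ∉ T → a ≠ k → u a = 0) → (∀ a, a ∉ T → a ≠ k → w a = 0) ∧ w k ≤ u k) := by
  obtain ⟨r, h1, h2⟩ := exists_linearOrder_above T k
  refine ⟨MonomialOrder.lex, fun u w h => ?_⟩
  rcases h.lt_or_eq with h | h
  swap
  · rw [MonomialOrder.lex.toSyn.injective h]
    exact ⟨id, fun h => ⟨h, le_rfl⟩⟩
  rw [MonomialOrder.lex_lt_iff, Finsupp.Lex.lt_iff] at h
  obtain ⟨i, hi, hlt⟩ := h
  simp only [ofLex_toLex] at hi hlt
  refine ⟨fun hu a ha => ?_, fun hu => ?_⟩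
  · have hiT : i ∈ T := by
      by_contra hc
      rw [hu i hc] at hlt
      omega
    rw [hi a (h1 i hiT a ha), hu a ha]
  · have hiT : i ∈ T ∨ i = k := by
      by_contra! hc
      rw [hu i hc.1 hc.2] at hlt
      omega
    refine ⟨fun a ha hak => ?_, ?_⟩
    · rcases hiT with hiT | rfl
      · rw [hi a (h1 i hiT a ha), hu a ha hak]
      · rw [hi a (h2 a ha hak), hu a ha hak]
    · rcases hiT with hiT | rfl
      · rw [hi k (h1 i hiT k hk)]
      · exact hlt.le

variable {A : Finset ℕ}

/-- A monomial is standard if it is the smallest one of its degree. -/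
def Std (m : MonomialOrder A) (v : A →₀ ℕ) : Prop :=
  ∀ w, degA w = degA v → m.toSyn v ≤ m.toSyn w

lemma exists_std (m : MonomialOrder A) (u : A →₀ ℕ) : ∃ v, degA v = degA u ∧ Std m v := by
  obtain ⟨x, hx, hmin⟩ := WellFounded.has_min (wellFounded_lt (α := m.syn))
    {x | degA (m.toSyn.symm x) = degA u} ⟨m.toSyn u, by simp⟩
  refine ⟨m.toSyn.symm x, hx, fun w hw => ?_⟩
  have := hmin (m.toSyn w) (by simpa using hw.trans hx)
  simpa using this

lemma Std.of_le {m : MonomialOrder A} {v w : A →₀ ℕ} (hv : Std m v) (h : w ≤ v) : Std m w := by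
  intro z hz
  have h1 := degA_sub h
  have := hv (z + (v - w)) (by rw [degA_add]; omega)
  rw [← add_tsub_cancel_of_le h, add_tsub_cancel_left, map_add, map_add] at this
  exact le_of_add_le_add_right this

lemma Std.eq {m : MonomialOrder A} {v w : A →₀ ℕ} (hv : Std m v) (hw : Std m w)
    (h : degA v = degA w) : v = w :=
  m.toSyn.injective (le_antisymm (hv w h.symm) (hw v h))

/-- The conditions for `x ^ u - x ^ v` to belong to the reduced Gröbner basis with respect
to `m`. -/
def IsReducedPair (m : MonomialOrder A) (u v : A →₀ ℕ) : Prop :=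
  u ≠ v ∧ degA u = degA v ∧ Std m v ∧ ∀ w, w < u → Std m w

lemma IsReducedPair.not_std {m : MonomialOrder A} {u v : A →₀ ℕ} (h : IsReducedPair m u v) :
    ¬ Std m u := fun hu => h.1 (hu.eq h.2.2.1 h.2.1)

lemma exists_isReducedPair {m : MonomialOrder A} {w : A →₀ ℕ} (h : ¬ Std m w) :
    ∃ u v, IsReducedPair m u v ∧ u ≤ w := by
  obtain ⟨u, huw, hu⟩ := exists_minimal_le_of_wellFoundedLT (fun u => ¬ Std m u) w h
  obtain ⟨v, hvd, hv⟩ := exists_std m u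
  refine ⟨u, v, ⟨fun e => hu.1 (e ▸ hv), hvd.symm, hv, fun z hz => ?_⟩, huw⟩
  by_contra hc
  exact absurd (hu.2 hc hz.le) hz.not_ge

variable (K : Type*) [Field K]

lemma lt_of_std {m : MonomialOrder A} {u v : A →₀ ℕ} (hne : u ≠ v) (hd : degA u = degA v)
    (hv : Std m v) : m.toSyn v < m.toSyn u :=
  lt_of_le_of_ne (hv u hd) fun h => hne (m.toSyn.injective h).symm

lemma degree_binom {m : MonomialOrder A} {u v : A →₀ ℕ} (h : m.toSyn v < m.toSyn u) :
    m.degree (binom K u v) = u := by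
  classical
  rw [binom, m.degree_sub_of_lt] <;> simp [m.degree_monomial, h]

lemma monic_binom {m : MonomialOrder A} {u v : A →₀ ℕ} (h : m.toSyn v < m.toSyn u) :
    m.Monic (binom K u v) := by
  classical
  rw [MonomialOrder.Monic, binom, m.leadingCoeff_sub_of_lt] <;> simp [m.degree_monomial, h]

lemma leadingTerm_of_monic {m : MonomialOrder A} {f : MvPolynomial A K} (h : m.Monic f) :
    m.leadingTerm f = monomial (m.degree f) 1 := by
  rw [MonomialOrder.leadingTerm, h.leadingCoeff_eq_one]

lemma not_std_degree {m : MonomialOrder A} {f : MvPolynomial A K} (hf : f ∈ toricIdeal K A)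
    (h0 : f ≠ 0) : ¬ Std m (m.degree f) := by
  intro hs
  obtain ⟨v, hv, hne, hd⟩ := exists_companion K hf (m.degree_mem_support h0)
  exact hne (m.toSyn.injective (le_antisymm (m.le_degree hv) (hs v hd)))

lemma isReducedGroebnerBasis_reducedPairs (m : MonomialOrder A) :
    IsReducedGroebnerBasis m (toricIdeal K A) {f | ∃ u v, IsReducedPair m u v ∧ f = binom K u v} := by
  classical
  have hsub : {f | ∃ u v, IsReducedPair m u v ∧ f = binom K u v} ⊆
      (toricIdeal K A : Set (MvPolynomial A K)) := by
    rintro _ ⟨u, v, h, rfl⟩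
    exact (binom_mem_toricIdeal K).2 h.2.1
  refine ⟨hsub, le_antisymm (Ideal.span_mono (Set.image_mono hsub)) (Ideal.span_le.2 ?_), ?_⟩
  · rintro _ ⟨f, hf, rfl⟩
    by_cases h0 : f = 0
    · simp [h0]
    obtain ⟨u, v, huv, hle⟩ := exists_isReducedPair (not_std_degree K (m := m) hf h0)
    have hlt := lt_of_std huv.1 huv.2.1 huv.2.2.1
    have h1 : m.leadingTerm (binom K u v) ∈ Ideal.span (m.leadingTerm ''
        {f | ∃ u v, IsReducedPair m u v ∧ f = binom K u v}) :=
      Ideal.subset_span ⟨_, ⟨u, v, huv, rfl⟩, rfl⟩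
    rw [leadingTerm_of_monic K (monic_binom K hlt), degree_binom K hlt] at h1
    have h2 : m.leadingTerm f =
        monomial (m.degree f - u) (m.leadingCoeff f) * monomial u 1 := by
      rw [monomial_mul, tsub_add_cancel_of_le hle, mul_one, MonomialOrder.leadingTerm]
    rw [h2]
    exact Ideal.mul_mem_left _ _ h1
  · rintro _ ⟨u, v, huv, rfl⟩
    have hlt := lt_of_std huv.1 huv.2.1 huv.2.2.1
    refine ⟨monic_binom K hlt, ?_⟩
    rintro d hd _ ⟨u', v', huv', rfl⟩ hne hle
    rw [degree_binom K (lt_of_std huv'.1 huv'.2.1 huv'.2.2.1)] at hle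
    rw [support_binom K huv.1, Finset.mem_insert, Finset.mem_singleton] at hd
    rcases hd with rfl | rfl
    · rcases hle.lt_or_eq with h | rfl
      · exact huv'.not_std (huv.2.2.2 _ h)
      · exact hne (by rw [huv'.2.2.1.eq huv.2.2.1 (huv'.2.1.symm.trans huv.2.1)])
    · exact huv'.not_std (huv.2.2.1.of_le hle)

/-- Subtract from `f` the binomial of its leading monomial `u` and the standard monomial `v` of that
degree. A nonzero difference would have a nonstandard leading monomial other than `u` and `v`, hence
a monomial of `f` that some leading monomial of `G` divides, against reducedness. -/
lemma exists_isReducedPair_of_mem {m : MonomialOrder A} {G : Set (MvPolynomial A K)}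
    (hG : IsReducedGroebnerBasis m (toricIdeal K A) G) {f : MvPolynomial A K} (hf : f ∈ G) :
    ∃ u v, IsReducedPair m u v ∧ f = binom K u v := by
  classical
  obtain ⟨hsub, hspan, hred⟩ := hG
  have hdiv : ∀ w, ¬ Std m w → ∃ g ∈ G, m.degree g ≤ w := by
    intro w hw
    obtain ⟨v, hvd, hv⟩ := exists_std m w
    have hlt := lt_of_std (fun e => hw (by rwa [e])) hvd.symm hv
    have h1 : m.leadingTerm (binom K w v) ∈ Ideal.span (m.leadingTerm '' G) := by
      rw [hspan]
      exact Ideal.subset_span ⟨_, (binom_mem_toricIdeal K).2 hvd.symm, rfl⟩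
    have h2 : m.leadingTerm '' G = (fun s => monomial s (1 : K)) '' (m.degree '' G) := by
      rw [Set.image_image]
      exact Set.image_congr fun g hg => leadingTerm_of_monic K (hred g hg).1
    rw [leadingTerm_of_monic K (monic_binom K hlt), degree_binom K hlt, h2,
      mem_ideal_span_monomial_image] at h1
    obtain ⟨_, ⟨g, hg, rfl⟩, hle⟩ := h1 w (by simp [mem_support_iff])
    exact ⟨g, hg, hle⟩
  set u := m.degree f with hu
  have hmonic := (hred f hf).1
  have hf0 : f ≠ 0 := hmonic.ne_zero
  have hus : u ∈ f.support := m.degree_mem_support hf0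
  have hustd : ¬ Std m u := not_std_degree K (hsub hf) hf0
  obtain ⟨v, hvd, hv⟩ := exists_std m u
  have hne : u ≠ v := fun e => hustd (e ▸ hv)
  have hfb : f = binom K u v := by
    by_contra hc
    have hh : f - binom K u v ∈ toricIdeal K A :=
      Ideal.sub_mem _ (hsub hf) ((binom_mem_toricIdeal K).2 hvd.symm)
    have hh0 : f - binom K u v ≠ 0 := sub_ne_zero.2 hc
    set d := m.degree (f - binom K u v) with hd
    have hds : coeff d (f - binom K u v) ≠ 0 := mem_support_iff.1 (m.degree_mem_support hh0)
    have hdstd : ¬ Std m d := not_std_degree K hh hh0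
    have hdu : d ≠ u := by
      intro e
      apply hds
      rw [e, coeff_sub, coeff_binom, if_pos rfl, if_neg hne.symm, sub_zero, hu,
        hmonic.coeff_degree, sub_self]
    have hdv : d ≠ v := fun e => hdstd (e ▸ hv)
    rw [coeff_sub, coeff_binom, if_neg hdu.symm, if_neg hdv.symm, sub_zero, sub_zero] at hds
    have hdf : d ∈ f.support := mem_support_iff.2 hds
    obtain ⟨g, hg, hgd⟩ := hdiv d hdstd
    by_cases hgf : g = f
    · subst hgf
      exact hdu (m.toSyn.injective (le_antisymm (m.le_degree hdf) (m.toSyn_monotone hgd)))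
    · exact (hred f hf).2 d hdf g hg hgf hgd
  refine ⟨u, v, ⟨hne, hvd.symm, hv, fun w hw => ?_⟩, hfb⟩
  by_contra hc
  obtain ⟨g, hg, hgw⟩ := hdiv w hc
  by_cases hgf : g = f
  · subst hgf
    exact absurd hgw hw.not_ge
  · exact (hred f hf).2 u hus g hg hgf (hgw.trans hw.le)

lemma mem_universalGroebnerBasis {f : MvPolynomial A K} : f ∈ universalGroebnerBasis K A ↔
    ∃ (m : MonomialOrder.{0, 0} A) (u v : A →₀ ℕ), IsReducedPair m u v ∧ f = binom K u v := by
  constructor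
  · rintro ⟨m, G, hG, hf⟩
    exact ⟨m, exists_isReducedPair_of_mem K hG hf⟩
  · rintro ⟨m, h⟩
    exact ⟨m, _, isReducedGroebnerBasis_reducedPairs K m, h⟩

lemma IsReducedPair.isPrimitive (hpos : ∀ a ∈ A, 0 < a) {m : MonomialOrder A} {u v : A →₀ ℕ}
    (h : IsReducedPair m u v) : IsPrimitive K u v := by
  refine (isPrimitive_iff K).2 ⟨h.1, h.2.1, fun w z hwz hd hw hz => ?_⟩
  rcases hw.lt_or_eq with hlt | rfl
  · exact absurd ((h.2.2.2 w hlt).eq (h.2.2.1.of_le hz) hd) hwz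
  · exact ⟨rfl, eq_of_le_of_degA_eq hpos hz (hd.symm.trans h.2.1)⟩

/-- The order makes `j` the smallest variable and `i` the next. A monomial below a power of `x_i`
then involves only `i` and `j`, and the exponent of `i` can drop only by multiples of `a_j / gcd
(a_i, a_j)`. -/
lemma circuits_subset_universalGroebnerBasis (hpos : ∀ a ∈ A, 0 < a) :
    circuits K A ⊆ universalGroebnerBasis K A := by
  classical
  intro f hf
  obtain ⟨i, j, hij, rfl⟩ := (mem_circuits K hpos).1 hf
  obtain ⟨m, hm⟩ := exists_eliminationOrder (T := {j}) (k := i) (by simpa using hij)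
  refine (mem_universalGroebnerBasis K).2 ⟨m, circ i j, circ j i,
    ⟨(isPrimitive_circ K hpos hij).1, degA_circ_comm i j, fun w hw => ?_, fun w hw z hz => ?_⟩, rfl⟩
  · by_contra! hlt
    have h1 := (hm _ _ hlt.le).1 (fun a ha => by
      rw [Finset.mem_singleton] at ha
      simp [circ, Ne.symm ha])
    have h2 : w = Finsupp.single j (w j) := eq_single_of_support_subset fun a ha => by
      by_contra hc
      exact Finsupp.mem_support_iff.1 ha (h1 a hc)
    rw [h2, circ, degA_single, degA_single] at hw
    rw [h2, Nat.eq_of_mul_eq_mul_right (hpos j j.2) hw] at hlt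
    exact lt_irrefl _ hlt
  · by_contra! hlt
    have hwi := eq_single_of_le_single hw.le
    have h1 := (hm _ _ hlt.le).2 (fun a _ ha => by
      rw [hwi]
      simp [Ne.symm ha])
    have h2 : (j : ℕ) ∣ degA (z.erase i) := by
      have := gcd_dvd_degA (u := z.erase i) (T := {j}) (support_erase_subset fun a ha => by
        by_contra hc
        rw [Finset.mem_insert, not_or] at hc
        exact Finsupp.mem_support_iff.1 ha (h1.1 a hc.2 hc.1))
      simpa using this
    have h3 := degA_erase z i
    rw [hz, hwi, degA_single] at h3
    have h4 : (w i - z i) * i = degA (z.erase i) := by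
      rw [Nat.sub_mul, ← h3, Nat.add_sub_cancel_left]
    obtain ⟨t, ht⟩ := h2
    have h5 := dvd_of_mul_eq_mul (hpos i i.2) (h4.trans (ht.trans (mul_comm _ _)))
    have hlt' : w i < (j : ℕ) / Nat.gcd i j := by
      have h6 : degA w < degA (circ i j) := degA_lt_of_lt hpos hw
      rw [hwi, circ, degA_single, degA_single] at h6
      exact lt_of_mul_lt_mul_right h6 (Nat.zero_le _)
    have h6 : w i - z i = 0 := Nat.eq_zero_of_dvd_of_lt h5 (by omega)
    have h7 : Finsupp.single i (z i) ≤ z := single_le_of_le le_rfl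
    have h8 : w i = z i := le_antisymm (by omega) h1.2
    rw [← h8, ← hwi] at h7
    exact absurd (m.toSyn_monotone h7) hlt.not_ge

/-- Bézout coefficients, split into positive and negative parts. -/
lemma exists_degA_eq_add {T : Finset A} {n : ℕ} (h : (T.gcd fun a => (a : ℕ)) ∣ n) :
    ∃ w z : A →₀ ℕ, w.support ⊆ T ∧ z.support ⊆ T ∧ n + degA w = degA z := by
  classical
  obtain ⟨y, hy⟩ := Finset.gcd_eq_sum_mul T fun a => ((a : ℕ) : ℤ)
  obtain ⟨t, ht⟩ : (T.gcd fun a => ((a : ℕ) : ℤ)) ∣ (n : ℤ) := by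
    rw [← Int.natAbs_dvd, Int.natCast_dvd_natCast]
    refine dvd_trans (Finset.dvd_gcd fun a ha => ?_) h
    rw [← Int.natCast_dvd_natCast, Int.natAbs_dvd]
    exact Finset.gcd_dvd ha
  have hT : ∀ f : A → ℕ, (Finsupp.onFinset T (fun a => if a ∈ T then f a else 0)
      fun a ha => by by_contra hc; simp [hc] at ha).support ⊆ T ∧
      degA (Finsupp.onFinset T (fun a => if a ∈ T then f a else 0)
      fun a ha => by by_contra hc; simp [hc] at ha) = ∑ a ∈ T, f a * (a : ℕ) := fun f => by
    refine ⟨Finsupp.support_onFinset_subset, ?_⟩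
    rw [degA, ← Finset.sum_subset (Finset.subset_univ T)]
    · exact Finset.sum_congr rfl fun a ha => by simp [ha]
    · intro a _ ha
      simp [ha]
  refine ⟨_, _, (hT fun a => (-(t * y a)).toNat).1, (hT fun a => (t * y a).toNat).1, ?_⟩
  rw [(hT _).2, (hT _).2]
  zify
  rw [ht, hy, Finset.sum_mul, ← Finset.sum_add_distrib]
  refine Finset.sum_congr rfl fun a _ => ?_
  have := Int.toNat_sub_toNat_neg (t * y a)
  linear_combination (-(a : ℤ)) * this

/-- Some multiple `x_k ^ c * x ^ w`, with `w` standard in the variables of `T`, has the degree of a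
monomial in `T`, hence is not standard. A reduced leading monomial dividing it belongs to a circuit,
on `k` because `w` is standard, and with the other variable in `T` because of the order. The bound
`c` on its exponent makes its degree `lcm (k, gcd T)`. -/
lemma freeStep_of_universalGroebnerBasis_subset (hpos : ∀ a ∈ A, 0 < a)
    (h : universalGroebnerBasis K A ⊆ circuits K A) {T : Finset A} {k : A} (hk : k ∉ T) :
    FreeStep T k := by
  classical
  set d := T.gcd fun a => (a : ℕ) with hd
  set c := d / Nat.gcd k d with hc
  have hck : c * k = Nat.lcm k d := div_gcd_mul _ _
  rcases Nat.eq_zero_or_pos d with hd0 | hd0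
  · exact ⟨0, by simp, by simp [← hd, hd0]⟩
  have hc0 : 0 < c := by
    have := Nat.lcm_pos (hpos k k.2) hd0
    rw [← hck] at this
    exact Nat.pos_of_mul_pos_right this
  obtain ⟨m, hm⟩ := exists_eliminationOrder hk
  obtain ⟨w₀, z, hw₀, hz, hwz⟩ := exists_degA_eq_add (T := T) (n := c * k)
    (hck ▸ Nat.dvd_lcm_right _ _)
  have zero_of : ∀ {u : A →₀ ℕ}, u.support ⊆ T → ∀ a, a ∉ T → u a = 0 := fun hu a ha =>
    Finsupp.notMem_support_iff.1 fun h => ha (hu h)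
  obtain ⟨w, hwd, hw⟩ := exists_std m w₀
  have hwT : ∀ a, a ∉ T → w a = 0 := (hm _ _ (hw w₀ hwd.symm)).1 (zero_of hw₀)
  have hu₀ : ¬ Std m (Finsupp.single k c + w) := by
    intro hs
    have h1 := hs z (by rw [degA_add, degA_single, hwd, hwz])
    have h2 := (hm _ _ h1).1 (zero_of hz) k hk
    simp at h2
    omega
  obtain ⟨u, v, huv, hle⟩ := exists_isReducedPair hu₀
  obtain ⟨i, j, hij, he⟩ := (mem_circuits K hpos).1
    (h ((mem_universalGroebnerBasis K).2 ⟨m, u, v, huv, rfl⟩))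
  obtain ⟨i, j, hij, rfl, rfl⟩ : ∃ i j, i ≠ j ∧ u = circ i j ∧ v = circ j i := by
    rcases binom_inj K huv.1 he with ⟨h1, h2⟩ | ⟨h1, h2⟩
    · exact ⟨i, j, hij, h1.symm, h2.symm⟩
    · exact ⟨j, i, hij.symm, h2.symm, h1.symm⟩
  have hlei : (j : ℕ) / Nat.gcd i j ≤ (Finsupp.single k c + w) i := by
    simpa [circ] using hle i
  have hik : i = k := by
    by_contra hne
    refine huv.not_std (hw.of_le (single_le_of_le ?_))
    simpa [Finsupp.single_eq_of_ne hne] using hlei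
  subst hik
  have hjT : j ∈ T := by
    by_contra hc
    have h1 := (hm _ _ (huv.2.2.1 _ huv.2.1)).2 (fun a _ ha => by
      simp [circ, Ne.symm ha])
    have h2 := h1.1 j hc hij.symm
    rw [circ, Finsupp.single_eq_same] at h2
    have := circ_pos hpos j i
    omega
  rw [Finsupp.add_apply, hwT i hk, Finsupp.single_eq_same, add_zero] at hlei
  refine ⟨circ j i, by rw [circ_support hpos]; simpa using hjT, ?_⟩
  refine Nat.dvd_antisymm ?_ ?_
  · rw [← degA_circ_comm, degA_circ, ← hck]
    have h1 : Nat.lcm i d ∣ Nat.lcm i j := Nat.lcm_dvd (Nat.dvd_lcm_left _ _) ((Finset.gcd_dvd hjT).trans (Nat.dvd_lcm_right _ _))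
    have h2 := Nat.mul_le_mul_right (i : ℕ) hlei
    rw [div_gcd_mul] at h2
    rw [← hck] at h1
    have h3 := Nat.le_of_dvd (Nat.lcm_pos (hpos i i.2) (hpos j j.2)) h1
    rw [le_antisymm h2 h3]
  · rw [← degA_circ_comm, degA_circ]
    exact Nat.lcm_dvd (Nat.dvd_lcm_left _ _) ((Finset.gcd_dvd hjT).trans (Nat.dvd_lcm_right _ _))

lemma F2_subset_F3 : F2 K ⊆ F3 := by
  rintro S ⟨A, hA, h⟩
  exact ⟨A, hA, universallyFree_of_freeStep fun T k _ hk =>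
    freeStep_of_universalGroebnerBasis_subset K hA.1 (ge_of_eq h) hk⟩

end Groebner

/-! ## Scaled fibers

If `c j * gcd (a_j, a_i)` divides `a_i` whenever `i ≠ j`, then the `j`-th exponents of two monomials
of equal degree are congruent modulo `c j`. -/

section Scaled

variable {A : Finset ℕ}

/-- The numbers `c j` are positive and `c j * gcd (a_j, a_i)` divides `a_i` for all `i ≠ j`. -/
def IsScaling (c : A → ℕ) : Prop :=
  (∀ j, 0 < c j) ∧ ∀ i j : A, i ≠ j → c j * Nat.gcd j i ∣ i

/-- With `d` the gcd of the other generators, `u j * j` and `v j * j` agree modulo `d`, and `c j`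
divides `d / gcd (j, d)`. -/
lemma IsScaling.modEq {c : A → ℕ} (hc : IsScaling c) (hpos : ∀ a ∈ A, 0 < a) {u v : A →₀ ℕ}
    (h : degA u = degA v) (j : A) : u j ≡ v j [MOD c j] := by
  classical
  set d := (Finset.univ.erase j).gcd fun a : A => (a : ℕ) with hd
  have hsub : ∀ x : A →₀ ℕ, x.support ⊆ insert j (Finset.univ.erase j) := fun x a _ => by
    simp
  have h1 : u j * j ≡ v j * j [MOD d] := by
    have hu := (Nat.modEq_zero_iff_dvd.2 (gcd_dvd_degA (support_erase_subset (hsub u)))).add_left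
      (u j * j)
    have hv := (Nat.modEq_zero_iff_dvd.2 (gcd_dvd_degA (support_erase_subset (hsub v)))).add_left
      (v j * j)
    rw [degA_erase] at hu hv
    rw [← h] at hv
    exact hu.symm.trans hv
  have hcd : c j * Nat.gcd j d ∣ d := by
    refine Finset.dvd_gcd fun i hi => ?_
    refine dvd_trans (Nat.mul_dvd_mul_left _ ?_) (hc.2 i j (Finset.ne_of_mem_erase hi))
    exact Nat.dvd_gcd (Nat.gcd_dvd_left _ _) ((Nat.gcd_dvd_right _ _).trans (Finset.gcd_dvd hi))
  rcases Nat.eq_zero_or_pos d with h0 | h0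
  · rw [h0, Nat.modEq_zero_iff] at h1
    rw [Nat.eq_of_mul_eq_mul_right (hpos j j.2) h1]
  · have h2 := Nat.ModEq.cancel_right_div_gcd h0 h1
    rw [Nat.gcd_comm] at h2
    refine h2.of_dvd ?_
    exact (Nat.dvd_div_iff_mul_dvd (Nat.gcd_dvd_right _ _)).2 (by rwa [mul_comm])

lemma IsScaling.dvd_of_isPrimitive {K : Type*} [Field K] {c : A → ℕ} (hc : IsScaling c)
    (hpos : ∀ a ∈ A, 0 < a) {u v : A →₀ ℕ} (h : IsPrimitive K u v) (j : A) : c j ∣ u j := by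
  have hm := hc.modEq hpos ((isPrimitive_iff K).1 h).2.1 j
  rcases h.disjoint K j with h0 | h0
  · simp [h0]
  · rw [h0] at hm
    exact Nat.modEq_zero_iff_dvd.1 hm

lemma eq_of_conn_of_isolated {u v : A →₀ ℕ} (hu : ∀ x, Linked u x → x = u) (h : Conn u v) :
    v = u := by
  induction h with
  | refl => rfl
  | tail _ h ih => exact hu _ (ih ▸ h)

/-- A monomial linked to the block `x_j ^ c j` has a positive multiple of `c j` as its exponent of
`j`, so the block divides it. -/
lemma IsScaling.eq_of_conn_single {c : A → ℕ} (hc : IsScaling c) (hpos : ∀ a ∈ A, 0 < a)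
    {j : A} {v : A →₀ ℕ} (h : Conn (Finsupp.single j (c j)) v) : v = Finsupp.single j (c j) := by
  refine eq_of_conn_of_isolated ?_ h
  rintro x ⟨hd, a, ha, hx⟩
  have haj : a = j := by
    by_contra hne
    simp [Finsupp.single_eq_of_ne hne] at ha
  subst haj
  have h1 := hc.modEq hpos hd a
  rw [Finsupp.single_eq_same] at h1
  have h2 : c a ∣ x a := Nat.modEq_zero_iff_dvd.1 (h1.symm.trans (by simp [Nat.ModEq]))
  exact (eq_of_le_of_degA_eq hpos (single_le_of_le (Nat.le_of_dvd hx h2)) hd).symm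

/-- Removing blocks of least degree, one reaches every common multiple of the block degrees. -/
lemma exists_le_degA_eq (hpos : ∀ a ∈ A, 0 < a) {c : A → ℕ} (hc : ∀ j, 0 < c j) {N : ℕ}
    (q : A →₀ ℕ)
    (hchain : ∀ i ∈ q.support, ∀ j ∈ q.support, c i * i ∣ c j * j ∨ c j * j ∣ c i * i)
    (hq : ∀ j, c j ∣ q j) (hN : ∀ i ∈ q.support, c i * i ∣ N) (h : N ≤ degA q) :
    ∃ q' ≤ q, degA q' = N := by
  classical
  induction hn : degA q using Nat.strong_induction_on generalizing q with
  | _ n ih =>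
    subst hn
    rcases h.lt_or_eq with hlt | heq
    swap
    · exact ⟨q, le_rfl, heq.symm⟩
    have hq0 : q.support.Nonempty := by
      rw [Finsupp.support_nonempty_iff]
      rintro rfl
      simp at hlt
    obtain ⟨i, hi, hmin⟩ := q.support.exists_min_image (fun i : A => c i * (i : ℕ)) hq0
    have hBi : 0 < c i * i := Nat.mul_pos (hc i) (hpos i i.2)
    have hdvd : ∀ j ∈ q.support, c i * i ∣ c j * j := fun j hj => by
      rcases hchain i hi j hj with h | h
      · exact h
      · rw [Nat.le_antisymm (hmin j hj) (Nat.le_of_dvd hBi h)]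
    have h1 : c i * i ∣ degA q := dvd_degA fun j hj => (hdvd j hj).trans
      (Nat.mul_dvd_mul_right (hq j) _)
    have h2 := hN i hi
    have h3 : N + c i * i ≤ degA q := by
      have := Nat.le_of_dvd (by omega) (Nat.dvd_sub h1 h2)
      omega
    have hle : Finsupp.single i (c i) ≤ q := single_le_of_le
      (Nat.le_of_dvd (Nat.pos_of_ne_zero (Finsupp.mem_support_iff.1 hi)) (hq i))
    have h4 := degA_sub hle
    rw [degA_single] at h4
    have hsub : ∀ j ∈ (q - Finsupp.single i (c i)).support, j ∈ q.support := fun j hj =>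
      Finsupp.mem_support_iff.2 fun h0 => by simp [h0] at hj
    obtain ⟨q', hq', hd⟩ := ih (degA (q - Finsupp.single i (c i))) (by omega)
      (q - Finsupp.single i (c i))
      (fun i hi j hj => hchain i (hsub i hi) j (hsub j hj)) (fun j => by
        rw [Finsupp.tsub_apply, Finsupp.single_apply]
        split_ifs with e
        · subst e
          exact Nat.dvd_sub (hq _) dvd_rfl
        · simpa using hq j)
      (fun j hj => hN j (hsub j hj)) (by omega) rfl
    exact ⟨q', hq'.trans tsub_le_self, hd⟩

variable (K : Type*) [Field K]

/-- If the block degrees form a chain, then one side of a primitive binomial is a single block. -/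
lemma IsScaling.exists_single_of_isPrimitive {c : A → ℕ} (hc : IsScaling c)
    (hpos : ∀ a ∈ A, 0 < a)
    (hchain : ∀ i j : A, c i * i ∣ c j * j ∨ c j * j ∣ c i * i) {u v : A →₀ ℕ}
    (h : IsPrimitive K u v) :
    ∃ j, (u = Finsupp.single j (c j) ∨ v = Finsupp.single j (c j)) ∧
      ∀ i, i ∈ u.support ∨ i ∈ v.support → c i * i ∣ c j * j := by
  classical
  have hne : (u.support ∪ v.support).Nonempty := by
    by_contra hc
    rw [Finset.not_nonempty_iff_eq_empty, Finset.union_eq_empty, Finsupp.support_eq_empty,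
      Finsupp.support_eq_empty] at hc
    exact h.1 (hc.1.trans hc.2.symm)
  obtain ⟨j, hj, hmax⟩ := (u.support ∪ v.support).exists_max_image (fun i : A => c i * (i : ℕ)) hne
  have hdvd : ∀ i, i ∈ u.support ∨ i ∈ v.support → c i * i ∣ c j * j := fun i hi => by
    rcases hchain i j with h | h
    · exact h
    · have h1 := hmax i (Finset.mem_union.2 hi)
      have h2 := Nat.le_of_dvd (Nat.mul_pos (hc.1 i) (hpos i i.2)) h
      rw [Nat.le_antisymm h1 h2]
  -- With the largest block in `u`, the other side contains a submonomial of the degree of that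
  -- block, and primitivity applies.
  have key : ∀ u v : A →₀ ℕ, IsPrimitive K u v → j ∈ u.support →
      (∀ i ∈ v.support, c i * i ∣ c j * j) → u = Finsupp.single j (c j) := by
    intro u v h hj hv
    have hju : Finsupp.single j (c j) ≤ u := single_le_of_le (Nat.le_of_dvd
      (Nat.pos_of_ne_zero (Finsupp.mem_support_iff.1 hj)) (hc.dvd_of_isPrimitive hpos h j))
    have hd := ((isPrimitive_iff K).1 h).2.1
    have h1 := degA_mono hju
    rw [degA_single, hd] at h1
    obtain ⟨q, hq, hqd⟩ := exists_le_degA_eq hpos hc.1 v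
      (fun i _ j _ => hchain i j) (hc.dvd_of_isPrimitive hpos h.symm) hv h1
    refine (((isPrimitive_iff K).1 h).2.2 _ q ?_ (by rw [degA_single, hqd]) hju hq).1.symm
    rintro rfl
    have h2 := hq j
    rw [Finsupp.single_eq_same,
      (h.disjoint K j).resolve_left (Finsupp.mem_support_iff.1 hj)] at h2
    have := hc.1 j
    omega
  refine ⟨j, ?_, hdvd⟩
  rcases Finset.mem_union.1 hj with hj | hj
  · exact Or.inl (key u v h hj fun i hi => hdvd i (Or.inr hi))
  · exact Or.inr (key v u h.symm hj fun i hi => hdvd i (Or.inl hi))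

lemma graverBasis_subset_of_not_conn (hpos : ∀ a ∈ A, 0 < a)
    (h : ∀ u v : A →₀ ℕ, IsPrimitive K u v → ¬ Conn u v) :
    universalMarkovBasis K A = graverBasis K A := by
  refine Set.Subset.antisymm (universalMarkovBasis_subset_graverBasis K hpos) ?_
  rintro _ ⟨u, v, huv, rfl⟩
  exact (mem_universalMarkovBasis K hpos huv.1).2 ⟨((isPrimitive_iff K).1 huv).2.1, h u v huv⟩

lemma circuits_eq_of_isReducedPair (hpos : ∀ a ∈ A, 0 < a)
    (h : ∀ (m : MonomialOrder.{0, 0} A) (u v : A →₀ ℕ), IsReducedPair m u v →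
      (∃ i s, u = Finsupp.single i s) ∧ ∃ j t, v = Finsupp.single j t) :
    circuits K A = universalGroebnerBasis K A := by
  refine Set.Subset.antisymm (circuits_subset_universalGroebnerBasis K hpos) ?_
  intro f hf
  obtain ⟨m, u, v, huv, rfl⟩ := (mem_universalGroebnerBasis K).1 hf
  obtain ⟨⟨i, s, rfl⟩, j, t, rfl⟩ := h m u v huv
  obtain ⟨hij, h1, h2⟩ := eq_circ_of_isPrimitive K hpos (huv.isPrimitive K hpos)
  exact (mem_circuits K hpos).2 ⟨i, j, hij, by rw [h1, h2]⟩

lemma IsScaling.not_conn_of_chain {c : A → ℕ} (hc : IsScaling c) (hpos : ∀ a ∈ A, 0 < a)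
    (hchain : ∀ i j : A, c i * i ∣ c j * j ∨ c j * j ∣ c i * i) {u v : A →₀ ℕ}
    (h : IsPrimitive K u v) : ¬ Conn u v := by
  intro hconn
  obtain ⟨j, rfl | rfl, -⟩ := hc.exists_single_of_isPrimitive K hpos hchain h
  · exact h.1 (hc.eq_of_conn_single hpos hconn).symm
  · exact h.1 (hc.eq_of_conn_single hpos hconn.symm)

/-- Let `j` carry the largest block of `y`. If other variables occur, their part of `y` contains a
monomial of degree `c j * j`. Together with `x_j ^ c j` this gives two standard monomials of one
degree. -/
lemma IsScaling.exists_eq_single {c : A → ℕ} (hc : IsScaling c) (hpos : ∀ a ∈ A, 0 < a)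
    (hchain : ∀ i j : A, c i * i ∣ c j * j ∨ c j * j ∣ c i * i) {m : MonomialOrder A}
    {y : A →₀ ℕ} (hy : ∀ j, c j ∣ y j) (hstd : ∀ w < y, Std m w) (hy0 : y ≠ 0)
    (hdvd : ∀ i ∈ y.support, c i * i ∣ degA y) : ∃ i s, y = Finsupp.single i s := by
  classical
  obtain ⟨j, hj, hmax⟩ := y.support.exists_max_image (fun i : A => c i * (i : ℕ))
    (Finsupp.support_nonempty_iff.2 hy0)
  have hyj : y j ≠ 0 := Finsupp.mem_support_iff.1 hj
  by_contra! hno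
  have hq0 : y.erase j ≠ 0 := fun h => hno j (y j) (by
    conv_lhs => rw [← Finsupp.single_add_erase j y, h, add_zero])
  have hqle : y.erase j ≤ y := fun a => by
    rw [Finsupp.erase_apply]
    split_ifs <;> simp
  have h1 : c j * j ∣ degA (y.erase j) := by
    have := hdvd j hj
    rw [← degA_erase y j] at this
    exact (Nat.dvd_add_right (Nat.mul_dvd_mul_right (hy j) _)).1 this
  obtain ⟨q, hq, hqd⟩ := exists_le_degA_eq hpos hc.1 (N := c j * j) (y.erase j)
    (fun i _ j _ => hchain i j) (fun a => by
      rw [Finsupp.erase_apply]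
      split_ifs
      · exact dvd_zero _
      · exact hy a)
    (fun i hi => by
      rw [Finsupp.support_erase] at hi
      rcases hchain i j with h | h
      · exact h
      · have h1 := hmax i (Finset.mem_of_mem_erase hi)
        have h2 := Nat.le_of_dvd (Nat.mul_pos (hc.1 i) (hpos i i.2)) h
        rw [Nat.le_antisymm h1 h2])
    (Nat.le_of_dvd (Nat.pos_of_ne_zero fun h => hq0 ((degA_eq_zero hpos).1 h)) h1)
  have hqj : q j = 0 := by
    have := hq j
    rw [Finsupp.erase_same] at this
    omega
  have hs1 : Std m q := hstd q (lt_of_le_of_ne (hq.trans hqle) fun e => hyj (e ▸ hqj))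
  have hs2 : Std m (Finsupp.single j (c j)) := hstd _ (lt_of_le_of_ne
    (single_le_of_le (Nat.le_of_dvd (Nat.pos_of_ne_zero hyj) (hy j))) (hno j (c j)).symm)
  have := hs1.eq hs2 (by rw [hqd, degA_single])
  rw [this, Finsupp.single_eq_same] at hqj
  have := hc.1 j
  omega

lemma IsScaling.pure_of_isReducedPair {c : A → ℕ} (hc : IsScaling c) (hpos : ∀ a ∈ A, 0 < a)
    (hchain : ∀ i j : A, c i * i ∣ c j * j ∨ c j * j ∣ c i * i) {m : MonomialOrder A}
    {u v : A →₀ ℕ} (h : IsReducedPair m u v) :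
    (∃ i s, u = Finsupp.single i s) ∧ ∃ j t, v = Finsupp.single j t := by
  have hp := h.isPrimitive ℚ hpos
  obtain ⟨j, hj, hdvd⟩ := hc.exists_single_of_isPrimitive ℚ hpos hchain hp
  have hdj : degA u = c j * j := by
    rcases hj with rfl | rfl
    · rw [degA_single]
    · rw [h.2.1, degA_single]
  have hd0 : degA u ≠ 0 := by
    rw [hdj]
    exact (Nat.mul_pos (hc.1 j) (hpos j j.2)).ne'
  constructor
  · refine hc.exists_eq_single hpos hchain (hc.dvd_of_isPrimitive hpos hp) h.2.2.2 ?_ ?_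
    · rintro rfl
      simp at hd0
    · exact fun i hi => hdj ▸ hdvd i (Or.inl hi)
  · refine hc.exists_eq_single hpos hchain (hc.dvd_of_isPrimitive hpos hp.symm)
      (fun w hw => h.2.2.1.of_le hw.le) ?_ ?_
    · rintro rfl
      exact hd0 (by rw [h.2.1, degA_zero])
    · exact fun i hi => h.2.1 ▸ hdj ▸ hdvd i (Or.inr hi)

end Scaled

/-! ## Betti divisible semigroups -/

section BettiDivisible

variable (K : Type*) [Field K] {A : Finset ℕ}

/-- If the Betti degrees form a chain, then so do the least common multiples of pairs of
generators, in the form of a scaling whose block degrees form a chain. -/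
lemma exists_isScaling (hpos : ∀ a ∈ A, 0 < a) [Nontrivial A]
    (hbetti : ∀ b ∈ bettiDegrees K A, ∀ c ∈ bettiDegrees K A, b ∣ c ∨ c ∣ b) :
    ∃ c : A → ℕ, IsScaling c ∧ ∀ i j : A, c i * i ∣ c j * j ∨ c j * j ∣ c i * i := by
  classical
  -- `c i` will be the least positive `t` for which `t * i` is generated by the other generators.
  let P : A → ℕ → Prop := fun i t => 0 < t ∧ ∃ w : A →₀ ℕ, w i = 0 ∧ degA w = t * i
  have hcirc : ∀ i j : A, i ≠ j → P i ((j : ℕ) / Nat.gcd i j) := fun i j hij =>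
    ⟨circ_pos hpos i j, circ j i, by simp [circ, hij], by
      rw [← degA_circ_comm, circ, degA_single]⟩
  have hex : ∀ i, ∃ t, P i t := fun i => by
    obtain ⟨j, hj⟩ := exists_ne i
    exact ⟨_, hcirc i j hj.symm⟩
  let c : A → ℕ := fun i => Nat.find (hex i)
  have hcP : ∀ i, P i (c i) := fun i => Nat.find_spec (hex i)
  have hmin : ∀ i t, P i t → c i ≤ t := fun i t h => Nat.find_min' (hex i) h
  have hB : ∀ i : A, c i * i ∈ bettiDegrees K A := fun i => by
    obtain ⟨h0, w, hwi, hwd⟩ := hcP i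
    have hne : Finsupp.single i (c i) ≠ w := by
      rintro rfl
      rw [Finsupp.single_eq_same] at hwi
      omega
    refine ⟨Finsupp.single i (c i), w, hne, (mem_universalMarkovBasis K hpos hne).2
      ⟨by rw [degA_single, hwd], fun hconn => ?_⟩, by rw [degA_single]⟩
    refine hne (eq_of_conn_of_isolated ?_ hconn).symm
    rintro x ⟨hd, a, ha, hx⟩
    have hai : a = i := by
      by_contra hne
      simp [Finsupp.single_eq_of_ne hne] at ha
    subst hai
    refine (eq_of_le_of_degA_eq hpos (single_le_of_le ?_) hd).symm
    by_contra! hlt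
    have h1 := degA_erase x a
    rw [← hd, degA_single] at h1
    -- Cancelling the common power of `x_a` would give a smaller multiple generated by the others.
    have := hmin a (c a - x a) ⟨by omega, x.erase a, by simp, by
      rw [Nat.sub_mul]; omega⟩
    omega
  have hchain : ∀ i j : A, c i * i ∣ c j * j ∨ c j * j ∣ c i * i := fun i j =>
    hbetti _ (hB i) _ (hB j)
  have hle : ∀ i j : A, i ≠ j → c i * i ≤ Nat.lcm i j := fun i j hij => by
    rw [← div_gcd_mul]
    exact Nat.mul_le_mul_right _ (hmin i _ (hcirc i j hij))
  have hlcm : ∀ i j : A, i ≠ j → c i * i ∣ c j * j → Nat.lcm i j = c j * j := fun i j hij h => by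
    refine le_antisymm (Nat.le_of_dvd (Nat.mul_pos (hcP j).1 (hpos j j.2)) ?_) ?_
    · exact Nat.lcm_dvd ((dvd_mul_left _ _).trans h) (dvd_mul_left _ _)
    · rw [Nat.lcm_comm]
      exact hle j i hij.symm
  refine ⟨c, ⟨fun j => (hcP j).1, fun i j hij => ?_⟩, hchain⟩
  -- The larger of two comparable block degrees is the least common multiple; multiplying by the gcd
  -- turns this into the scaling condition.
  have h1 : c j * j ∣ Nat.lcm i j := by
    rcases hchain i j with h | h
    · rw [hlcm i j hij h]
    · rw [Nat.lcm_comm, hlcm j i hij.symm h]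
      exact h
  have hj := hpos j j.2
  refine Nat.dvd_of_mul_dvd_mul_right hj ?_
  have h2 := Nat.mul_dvd_mul_right h1 (Nat.gcd i j)
  rw [Nat.lcm_comm, Nat.gcd_comm, mul_comm (Nat.lcm _ _), Nat.gcd_mul_lcm] at h2
  rwa [mul_right_comm, mul_comm (i : ℕ)]

lemma F0_subset : F0 K ⊆ F1 K ∩ F2 K := by
  rintro S ⟨A, hA, h⟩
  have hpos := hA.1
  rcases subsingleton_or_nontrivial A with hs | hn
  · have heq : ∀ u v : A →₀ ℕ, degA u = degA v → u = v := fun u v huv => by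
      ext a
      have h1 : ∀ x : A →₀ ℕ, x = Finsupp.single a (x a) := fun x =>
        eq_single_of_support_subset fun b _ => by simp [Subsingleton.elim b a]
      rw [h1 u, h1 v, degA_single, degA_single] at huv
      exact Nat.eq_of_mul_eq_mul_right (hpos a a.2) huv
    exact ⟨⟨A, hA, graverBasis_subset_of_not_conn K hpos fun u v huv =>
      absurd (heq u v ((isPrimitive_iff K).1 huv).2.1) huv.1⟩,
      A, hA, circuits_eq_of_isReducedPair K hpos fun m u v huv =>
      absurd (heq u v huv.2.1) huv.1⟩
  · obtain ⟨c, hc, hchain⟩ := exists_isScaling K hpos h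
    exact ⟨⟨A, hA, graverBasis_subset_of_not_conn K hpos fun u v huv =>
      hc.not_conn_of_chain K hpos hchain huv⟩,
      A, hA, circuits_eq_of_isReducedPair K hpos fun m u v huv =>
      hc.pure_of_isReducedPair hpos hchain huv⟩

end BettiDivisible

/-! ## Minimal generating sets -/

section MinGenSet

lemma isMinGenSet_of_notMem {A : Finset ℕ} (hpos : ∀ a ∈ A, 0 < a) (hgcd : A.gcd id = 1)
    (h : ∀ a ∈ A, a ∉ AddSubmonoid.closure ((A.erase a : Finset ℕ) : Set ℕ)) :
    IsMinGenSet A (AddSubmonoid.closure (A : Set ℕ)) := by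
  refine ⟨hpos, hgcd, rfl, fun B hB he => ?_⟩
  obtain ⟨a, ha, haB⟩ := Finset.exists_of_ssubset hB
  refine h a ha (AddSubmonoid.closure_mono ?_ (he ▸ AddSubmonoid.subset_closure ha))
  intro b hb
  exact Finset.mem_erase.2 ⟨fun e => haB (e ▸ hb), hB.1 hb⟩

lemma mem_closure_erase_of_lt {A : Finset ℕ} {a x : ℕ}
    (hx : x ∈ AddSubmonoid.closure (A : Set ℕ)) (hlt : x < a) :
    x ∈ AddSubmonoid.closure ((A.erase a : Finset ℕ) : Set ℕ) := by
  induction hx using AddSubmonoid.closure_induction with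
  | mem y hy => exact AddSubmonoid.subset_closure (Finset.mem_erase.2 ⟨hlt.ne, hy⟩)
  | zero => exact AddSubmonoid.zero_mem _
  | add y z _ _ hy hz => exact AddSubmonoid.add_mem _ (hy (by omega)) (hz (by omega))

/-- If `a ∉ B`, only elements of `B` below `a` serve to generate `a`, and these are generated by
elements of `A` below `a`. -/
lemma IsMinGenSet.subset {A B : Finset ℕ} {S : AddSubmonoid ℕ} (hA : IsMinGenSet A S)
    (hB : IsMinGenSet B S) : A ⊆ B := by
  intro a ha
  by_contra haB
  have key : ∀ x ∈ AddSubmonoid.closure (B : Set ℕ), x ≤ a →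
      x ∈ AddSubmonoid.closure ((A.erase a : Finset ℕ) : Set ℕ) := by
    intro x hx hle
    induction hx using AddSubmonoid.closure_induction with
    | mem y hy =>
      refine mem_closure_erase_of_lt ?_ (lt_of_le_of_ne hle fun e => haB (e ▸ hy))
      rw [hA.2.2.1, ← hB.2.2.1]
      exact AddSubmonoid.subset_closure hy
    | zero => exact AddSubmonoid.zero_mem _
    | add y z _ _ hy hz => exact AddSubmonoid.add_mem _ (hy (by omega)) (hz (by omega))
  have haS : a ∈ AddSubmonoid.closure (B : Set ℕ) := by
    rw [hB.2.2.1, ← hA.2.2.1]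
    exact AddSubmonoid.subset_closure ha
  have hmem := key a haS le_rfl
  refine hA.2.2.2 _ (Finset.erase_ssubset ha) (le_antisymm ?_ ?_)
  · rw [← hA.2.2.1]
    exact AddSubmonoid.closure_mono (Finset.erase_subset a A)
  · rw [← hA.2.2.1, AddSubmonoid.closure_le]
    intro b hb
    by_cases hba : b = a
    · exact hba ▸ hmem
    · exact AddSubmonoid.subset_closure (Finset.mem_erase.2 ⟨hba, hb⟩)

lemma IsMinGenSet.unique {A B : Finset ℕ} {S : AddSubmonoid ℕ} (hA : IsMinGenSet A S)
    (hB : IsMinGenSet B S) : A = B :=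
  Finset.Subset.antisymm (hA.subset hB) (hB.subset hA)

lemma mem_family_iff {A : Finset ℕ} {S : AddSubmonoid ℕ} (hA : IsMinGenSet A S)
    {P : Finset ℕ → Prop} : S ∈ family P ↔ P A := by
  refine ⟨?_, fun h => ⟨A, hA, h⟩⟩
  rintro ⟨B, hB, h⟩
  rwa [hA.unique hB]

lemma notMem_closure_of {s : Set ℕ} {a : ℕ} (P : ℕ → Prop) (hs : ∀ x ∈ s, P x) (h0 : P 0)
    (hadd : ∀ x y, P x → P y → P (x + y)) (ha : ¬ P a) : a ∉ AddSubmonoid.closure s := by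
  intro h
  apply ha
  clear ha
  induction h using AddSubmonoid.closure_induction with
  | mem x hx => exact hs x hx
  | zero => exact h0
  | add x y _ _ hx hy => exact hadd x y hx hy

end MinGenSet

/-! ## A semigroup in `F1 ∩ F2` that is not Betti divisible -/

section TwoScales

/-- The generators `60, 84, 350, 525`: their block degrees are `420, 420, 1050, 1050`. -/
def twoScales : Finset ℕ := {60, 84, 350, 525}

lemma isMinGenSet_twoScales :
    IsMinGenSet twoScales (AddSubmonoid.closure (twoScales : Set ℕ)) := by
  refine isMinGenSet_of_notMem (by decide) (by decide) ?_
  intro a ha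
  simp only [twoScales, Finset.mem_insert, Finset.mem_singleton] at ha
  rcases ha with rfl | rfl | rfl | rfl
  · refine notMem_closure_of (fun x => x = 0 ∨ 84 ≤ x) ?_ (by simp) (by intros; omega) (by omega)
    intro x hx
    simp [twoScales] at hx
    omega
  · refine notMem_closure_of (fun x => x = 0 ∨ x = 60 ∨ 120 ≤ x) ?_ (by simp) (by intros; omega)
      (by omega)
    intro x hx
    simp [twoScales] at hx
    omega
  · refine notMem_closure_of (fun x => 12 ∣ x ∨ 525 ≤ x) ?_ (by simp) (by intros; omega) (by omega)
    intro x hx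
    simp [twoScales] at hx
    omega
  · refine notMem_closure_of (fun x => 2 ∣ x) ?_ (by simp) (by intros; omega) (by omega)
    intro x hx
    simp [twoScales] at hx
    omega

lemma twoScales_pos : ∀ a ∈ twoScales, 0 < a := by decide

namespace TwoScales

def g₁ : twoScales := ⟨60, by decide⟩
def g₂ : twoScales := ⟨84, by decide⟩
def g₃ : twoScales := ⟨350, by decide⟩
def g₄ : twoScales := ⟨525, by decide⟩

lemma eq_or (a : twoScales) : a = g₁ ∨ a = g₂ ∨ a = g₃ ∨ a = g₄ := by
  revert a
  decide

/-- The scaling `7, 5, 3, 2`. -/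
def scale (a : twoScales) : ℕ :=
  if a = g₁ then 7 else if a = g₂ then 5 else if a = g₃ then 3 else 2

lemma isScaling : IsScaling scale := by
  constructor <;> decide

lemma degA_eq (u : twoScales →₀ ℕ) :
    degA u = u g₁ * 60 + u g₂ * 84 + u g₃ * 350 + u g₄ * 525 := by
  have : (Finset.univ : Finset twoScales) = {g₁, g₂, g₃, g₄} := by decide
  rw [degA, this, Finset.sum_insert (by decide), Finset.sum_insert (by decide),
    Finset.sum_insert (by decide), Finset.sum_singleton]
  simp only [g₁, g₂, g₃, g₄]
  ring

lemma dvds {u : twoScales →₀ ℕ} (h : ∀ j, scale j ∣ u j) :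
    7 ∣ u g₁ ∧ 5 ∣ u g₂ ∧ 3 ∣ u g₃ ∧ 2 ∣ u g₄ :=
  ⟨h g₁, h g₂, h g₃, h g₄⟩

variable (K : Type*) [Field K]

lemma eq_single_of_isPrimitive {u v : twoScales →₀ ℕ} (h : IsPrimitive K u v)
    {i j : twoScales} (hij : scale i * i = scale j * j) (hi : 0 < u i) (hj : 0 < v j) :
    u = Finsupp.single i (scale i) ∧ v = Finsupp.single j (scale j) := by
  have h1 := isScaling.dvd_of_isPrimitive twoScales_pos h i
  have h2 := isScaling.dvd_of_isPrimitive twoScales_pos h.symm j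
  have hne : i ≠ j := by
    rintro rfl
    have := h.disjoint K i
    omega
  have := ((isPrimitive_iff K).1 h).2.2 (Finsupp.single i (scale i)) (Finsupp.single j (scale j))
    (fun e => by
      have := DFunLike.congr_fun e i
      rw [Finsupp.single_eq_same, Finsupp.single_eq_of_ne hne] at this
      have := isScaling.1 i
      omega)
    (by rw [degA_single, degA_single, hij]) (single_le_of_le (Nat.le_of_dvd hi h1))
    (single_le_of_le (Nat.le_of_dvd hj h2))
  exact ⟨this.1.symm, this.2.symm⟩

/-- A primitive binomial is a circuit in one of the scales, or it connects the two scales. -/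
lemma cases_of_isPrimitive {u v : twoScales →₀ ℕ} (h : IsPrimitive K u v) :
    (∃ i j, u = Finsupp.single i (scale i) ∧ v = Finsupp.single j (scale j)) ∨
      (u g₃ = 0 ∧ u g₄ = 0 ∧ v g₁ = 0 ∧ v g₂ = 0) ∨
      (v g₃ = 0 ∧ v g₄ = 0 ∧ u g₁ = 0 ∧ u g₂ = 0) := by
  by_cases hc : ∃ i j : twoScales, scale i * i = scale j * j ∧ 0 < u i ∧ 0 < v j
  · obtain ⟨i, j, hij, hi, hj⟩ := hc
    obtain ⟨h1, h2⟩ := eq_single_of_isPrimitive K h hij hi hj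
    exact Or.inl ⟨i, j, h1, h2⟩
  · right
    push Not at hc
    have hd := ((isPrimitive_iff K).1 h).2.1
    rw [degA_eq, degA_eq] at hd
    have h12 := hc g₁ g₂ (by decide)
    have h21 := hc g₂ g₁ (by decide)
    have h34 := hc g₃ g₄ (by decide)
    have h43 := hc g₄ g₃ (by decide)
    have d1 := h.disjoint K g₁
    have d2 := h.disjoint K g₂
    have d3 := h.disjoint K g₃
    have d4 := h.disjoint K g₄
    by_cases hu : u g₁ = 0 ∧ u g₂ = 0
    · by_cases hv : v g₃ = 0 ∧ v g₄ = 0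
      · exact Or.inr ⟨hv.1, hv.2, hu.1, hu.2⟩
      · have hu3 : u g₃ = 0 := by clear hd h12 h21 d1 d2; omega
        have hu4 : u g₄ = 0 := by clear hd h12 h21 d1 d2; omega
        -- Here `u` vanishes, so its degree is `0` while that of `v` is not.
        clear h12 h21 h34 h43 d1 d2 d3 d4
        omega
    · have hv1 : v g₁ = 0 := by clear hd h34 h43 d3 d4; omega
      have hv2 : v g₂ = 0 := by clear hd h34 h43 d3 d4; omega
      by_cases hu' : u g₃ = 0 ∧ u g₄ = 0
      · exact Or.inl ⟨hu'.1, hu'.2, hv1, hv2⟩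
      · have hv3 : v g₃ = 0 := by clear hd h12 h21 d1 d2; omega
        have hv4 : v g₄ = 0 := by clear hd h12 h21 d1 d2; omega
        clear h12 h21 h34 h43 d1 d2 d3 d4
        omega

lemma dvd_2100 (i : twoScales) : scale i * i ∣ 2100 := by
  revert i
  decide

/-- The degree is a positive multiple of `420` and of `1050`; primitivity brings it down to `lcm
(420, 1050) = 2100`. As `2100 = 420 * s + 1050 * t` only for `(s, t) = (5, 0)` or `(0, 2)`, no
monomial of the fiber mixes the scales, and links stay within one. -/
lemma not_conn_of_scales {u v : twoScales →₀ ℕ} (h : IsPrimitive K u v)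
    (hu : u g₃ = 0 ∧ u g₄ = 0) (hv : v g₁ = 0 ∧ v g₂ = 0) : ¬ Conn u v := by
  have hp := (isPrimitive_iff K).1 h
  have du := isScaling.dvd_of_isPrimitive twoScales_pos h
  have dv := isScaling.dvd_of_isPrimitive twoScales_pos h.symm
  obtain ⟨u1, u2, u3, u4⟩ := dvds du
  obtain ⟨v1, v2, v3, v4⟩ := dvds dv
  have hd := hp.2.1
  have hd0 : degA u ≠ 0 := fun h0 => hp.1 (by
    have h0' : degA v = 0 := hd ▸ h0
    rw [(degA_eq_zero twoScales_pos).1 h0, (degA_eq_zero twoScales_pos).1 h0'])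
  have hdu := degA_eq u
  have hdv := degA_eq v
  have hge : 2100 ≤ degA u := by omega
  have hchu : ∀ i ∈ u.support, ∀ j ∈ u.support,
      scale i * i ∣ scale j * j ∨ scale j * j ∣ scale i * i := by
    have : ∀ i ∈ u.support, scale i * i = 420 := fun i hi => by
      rcases eq_or i with rfl | rfl | rfl | rfl
      · decide
      · decide
      · exact absurd hu.1 (Finsupp.mem_support_iff.1 hi)
      · exact absurd hu.2 (Finsupp.mem_support_iff.1 hi)
    intro i hi j hj
    rw [this i hi, this j hj]
    exact Or.inl dvd_rfl
  have hchv : ∀ i ∈ v.support, ∀ j ∈ v.support,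
      scale i * i ∣ scale j * j ∨ scale j * j ∣ scale i * i := by
    have : ∀ i ∈ v.support, scale i * i = 1050 := fun i hi => by
      rcases eq_or i with rfl | rfl | rfl | rfl
      · exact absurd hv.1 (Finsupp.mem_support_iff.1 hi)
      · exact absurd hv.2 (Finsupp.mem_support_iff.1 hi)
      · decide
      · decide
    intro i hi j hj
    rw [this i hi, this j hj]
    exact Or.inl dvd_rfl
  obtain ⟨p, hpu, hpd⟩ := exists_le_degA_eq twoScales_pos isScaling.1 u hchu du
    (fun i _ => dvd_2100 i) hge
  obtain ⟨q, hqv, hqd⟩ := exists_le_degA_eq twoScales_pos isScaling.1 v hchv dv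
    (fun i _ => dvd_2100 i) (hd ▸ hge)
  have hpq : p ≠ q := by
    rintro rfl
    have hp' := degA_eq p
    have h1 := hpu g₃
    have h2 := hpu g₄
    have h3 := hqv g₁
    have h4 := hqv g₂
    omega
  obtain ⟨rfl, rfl⟩ := hp.2.2 p q hpq (hpd.trans hqd.symm) hpu hqv
  have key : ∀ x, Conn p x → x g₃ = 0 ∧ x g₄ = 0 := by
    intro x hx
    induction hx with
    | refl => exact hu
    | @tail y x hpy hyx ih =>
      obtain ⟨hdyx, a, ha, hax⟩ := hyx
      have hdx : degA p = degA x := (Conn.degA_eq hpy).trans hdyx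
      have hx' := degA_eq x
      obtain ⟨x1, x2, x3, x4⟩ := dvds (u := x) fun j =>
        ((isScaling.modEq twoScales_pos hdx j).dvd_iff dvd_rfl).1 (du j)
      rcases eq_or a with rfl | rfl | rfl | rfl <;> omega
  intro hconn
  have := key q hconn
  omega

lemma not_conn_of_isPrimitive {u v : twoScales →₀ ℕ} (h : IsPrimitive K u v) : ¬ Conn u v := by
  rcases cases_of_isPrimitive K h with ⟨i, j, rfl, rfl⟩ | ⟨h1, h2, h3, h4⟩ | ⟨h1, h2, h3, h4⟩
  · exact fun hc => h.1 (isScaling.eq_of_conn_single twoScales_pos hc).symm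
  · exact not_conn_of_scales K h ⟨h1, h2⟩ ⟨h3, h4⟩
  · exact fun hc => not_conn_of_scales K h.symm ⟨h1, h2⟩ ⟨h3, h4⟩ hc.symm

/-- Otherwise two distinct blocks of equal degree would both be proper divisors of `y`, hence both
standard. -/
lemma eq_zero_or_eq_zero_of_std {m : MonomialOrder twoScales} {y : twoScales →₀ ℕ}
    (hy : ∀ j, scale j ∣ y j) (hstd : ∀ w < y, Std m w) {i j : twoScales} (hne : i ≠ j)
    (hij : scale i * i = scale j * j) : y i = 0 ∨ y j = 0 := by
  by_contra! hc
  have hlt : ∀ k l : twoScales, k ≠ l → y k ≠ 0 → y l ≠ 0 → Finsupp.single k (scale k) < y :=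
    fun k l hkl hk hl => lt_of_le_of_ne
      (single_le_of_le (Nat.le_of_dvd (Nat.pos_of_ne_zero hk) (hy k)))
      fun e => hl (by rw [← e, Finsupp.single_eq_of_ne hkl.symm])
  have := (hstd _ (hlt i j hne hc.1 hc.2)).eq (hstd _ (hlt j i hne.symm hc.2 hc.1))
    (by rw [degA_single, degA_single, hij])
  have := DFunLike.congr_fun this i
  rw [Finsupp.single_eq_same, Finsupp.single_eq_of_ne hne] at this
  have := isScaling.1 i
  omega

lemma exists_eq_single {m : MonomialOrder twoScales} {y : twoScales →₀ ℕ}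
    (hy : ∀ j, scale j ∣ y j) (hstd : ∀ w < y, Std m w)
    (h0 : (y g₃ = 0 ∧ y g₄ = 0) ∨ (y g₁ = 0 ∧ y g₂ = 0)) : ∃ i s, y = Finsupp.single i s := by
  have h12 := eq_zero_or_eq_zero_of_std hy hstd (i := g₁) (j := g₂) (by decide) (by decide)
  have h34 := eq_zero_or_eq_zero_of_std hy hstd (i := g₃) (j := g₄) (by decide) (by decide)
  have key : ∀ i, (∀ a, a ≠ i → y a = 0) → ∃ i s, y = Finsupp.single i s := fun i hi =>
    ⟨i, y i, eq_single_of_support_subset fun a ha => by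
      by_contra hc
      exact Finsupp.mem_support_iff.1 ha (hi a (by simpa using hc))⟩
  rcases h0 with h0 | h0
  · rcases h12 with h | h
    · refine key g₂ fun a ha => ?_
      rcases eq_or a with rfl | rfl | rfl | rfl <;> first | omega | exact absurd rfl ha
    · refine key g₁ fun a ha => ?_
      rcases eq_or a with rfl | rfl | rfl | rfl <;> first | omega | exact absurd rfl ha
  · rcases h34 with h | h
    · refine key g₄ fun a ha => ?_
      rcases eq_or a with rfl | rfl | rfl | rfl <;> first | omega | exact absurd rfl ha
    · refine key g₃ fun a ha => ?_
      rcases eq_or a with rfl | rfl | rfl | rfl <;> first | omega | exact absurd rfl ha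

lemma pure_of_isReducedPair {m : MonomialOrder twoScales} {u v : twoScales →₀ ℕ}
    (h : IsReducedPair m u v) :
    (∃ i s, u = Finsupp.single i s) ∧ ∃ j t, v = Finsupp.single j t := by
  have hp := h.isPrimitive ℚ twoScales_pos
  have du := isScaling.dvd_of_isPrimitive twoScales_pos hp
  have dv := isScaling.dvd_of_isPrimitive twoScales_pos hp.symm
  have sv : ∀ w < v, Std m w := fun w hw => h.2.2.1.of_le hw.le
  rcases cases_of_isPrimitive ℚ hp with ⟨i, j, rfl, rfl⟩ | ⟨h1, h2, h3, h4⟩ | ⟨h1, h2, h3, h4⟩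
  · exact ⟨⟨_, _, rfl⟩, _, _, rfl⟩
  · exact ⟨exists_eq_single du h.2.2.2 (Or.inl ⟨h1, h2⟩),
      exists_eq_single dv sv (Or.inr ⟨h3, h4⟩)⟩
  · exact ⟨exists_eq_single du h.2.2.2 (Or.inr ⟨h3, h4⟩),
      exists_eq_single dv sv (Or.inl ⟨h1, h2⟩)⟩

lemma mem_bettiDegrees {i j : twoScales} (hij : i ≠ j) (h : scale i * i = scale j * j) :
    scale i * i ∈ bettiDegrees K twoScales := by
  have hne : Finsupp.single i (scale i) ≠ Finsupp.single j (scale j) := fun e => by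
    have := DFunLike.congr_fun e i
    rw [Finsupp.single_eq_same, Finsupp.single_eq_of_ne hij] at this
    have := isScaling.1 i
    omega
  refine ⟨_, _, hne, (mem_universalMarkovBasis K twoScales_pos hne).2
    ⟨by rw [degA_single, degA_single, h], fun hc => ?_⟩, by rw [degA_single]⟩
  exact hne (isScaling.eq_of_conn_single twoScales_pos hc).symm

end TwoScales

variable (K : Type*) [Field K]

lemma exists_mem_F1_inter_F2_notMem_F0 : ∃ S ∈ F1 K ∩ F2 K, S ∉ F0 K := by
  refine ⟨_, ⟨(mem_family_iff isMinGenSet_twoScales).2 ?_,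
    (mem_family_iff isMinGenSet_twoScales).2 ?_⟩, fun h => ?_⟩
  · exact graverBasis_subset_of_not_conn K twoScales_pos fun u v h =>
      TwoScales.not_conn_of_isPrimitive K h
  · exact circuits_eq_of_isReducedPair K twoScales_pos fun m u v h =>
      TwoScales.pure_of_isReducedPair h
  · have := (mem_family_iff isMinGenSet_twoScales).1 h _
      (TwoScales.mem_bettiDegrees K (i := TwoScales.g₁) (j := TwoScales.g₂) (by decide) (by decide))
      _ (TwoScales.mem_bettiDegrees K (i := TwoScales.g₃) (j := TwoScales.g₄) (by decide)
        (by decide))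
    revert this
    decide

end TwoScales

/-! ## A circuit semigroup that is not universally free -/

section CircuitNotFree

/-- The generators `4, 6, 9`. -/
def fourSixNine : Finset ℕ := {4, 6, 9}

lemma isMinGenSet_fourSixNine :
    IsMinGenSet fourSixNine (AddSubmonoid.closure (fourSixNine : Set ℕ)) := by
  refine isMinGenSet_of_notMem (by decide) (by decide) ?_
  intro a ha
  simp only [fourSixNine, Finset.mem_insert, Finset.mem_singleton] at ha
  rcases ha with rfl | rfl | rfl
  · refine notMem_closure_of (fun x => x = 0 ∨ 6 ≤ x) ?_ (by simp) (by intros; omega) (by omega)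
    intro x hx
    simp [fourSixNine] at hx
    omega
  · refine notMem_closure_of (fun x => x = 0 ∨ x = 4 ∨ 8 ≤ x) ?_ (by simp) (by intros; omega)
      (by omega)
    intro x hx
    simp [fourSixNine] at hx
    omega
  · refine notMem_closure_of (fun x => 2 ∣ x) ?_ (by simp) (by intros; omega) (by omega)
    intro x hx
    simp [fourSixNine] at hx
    omega

lemma fourSixNine_pos : ∀ a ∈ fourSixNine, 0 < a := by decide

namespace FourSixNine

def g₁ : fourSixNine := ⟨4, by decide⟩
def g₂ : fourSixNine := ⟨6, by decide⟩
def g₃ : fourSixNine := ⟨9, by decide⟩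

lemma degA_eq (u : fourSixNine →₀ ℕ) : degA u = u g₁ * 4 + u g₂ * 6 + u g₃ * 9 := by
  have : (Finset.univ : Finset fourSixNine) = {g₁, g₂, g₃} := by decide
  rw [degA, this, Finset.sum_insert (by decide), Finset.sum_insert (by decide),
    Finset.sum_singleton]
  simp only [g₁, g₂, g₃]
  ring

lemma not_universallyFree : ¬ UniversallyFree fourSixNine := by
  intro h
  obtain ⟨w, hw, hd⟩ := freeStep_of_universallyFree h (T := {g₁, g₃}) (k := g₂) (by decide)
  have h2 : w g₂ = 0 := Finsupp.notMem_support_iff.1 fun hc => absurd (hw hc) (by decide)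
  have h6 : Nat.lcm g₂ (({g₁, g₃} : Finset fourSixNine).gcd fun a => (a : ℕ)) = 6 := by decide
  rw [h6, degA_eq, h2] at hd
  omega

variable (K : Type*) [Field K]

/-- The arrangement `(9, 4, 6)` is free, and both of its rules are circuits: `lcm (4, 6) = 2 * 6`
and `lcm (9, gcd (4, 6)) = 3 * 6`. -/
lemma toricIdeal_eq : toricIdeal K fourSixNine = Ideal.span (circuits K fourSixNine) := by
  refine toricIdeal_eq_span_circuits K fourSixNine_pos ?_
  set R := idealCon K (Ideal.span (circuits K fourSixNine)) with hR
  have hcirc : ∀ i j, i ≠ j → R (circ i j) (circ j i) := fun i j hij =>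
    Ideal.subset_span ((mem_circuits K fourSixNine_pos).2 ⟨i, j, hij, rfl⟩)
  have h0 : ∀ p q : fourSixNine →₀ ℕ, p.support ⊆ ∅ → q.support ⊆ ∅ → degA p = degA q →
      R p q := by
    intro p q hp hq _
    rw [Finset.subset_empty, Finsupp.support_eq_empty] at hp hq
    rw [hp, hq]
    exact R.refl _
  have h1 : ∀ p q : fourSixNine →₀ ℕ, p.support ⊆ insert g₂ ∅ → q.support ⊆ insert g₂ ∅ →
      degA p = degA q → R p q := fun p q hp hq =>
    -- Over the empty set the gcd and the exponent of the rule are `0`, so the rule is trivial.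
    con_insert fourSixNine_pos h0 (w := 0) (by simp) (by simp)
      (by simpa using R.refl 0) hp hq
  have h2 : ∀ p q : fourSixNine →₀ ℕ, p.support ⊆ insert g₁ (insert g₂ ∅) →
      q.support ⊆ insert g₁ (insert g₂ ∅) → degA p = degA q → R p q := fun p q hp hq =>
    con_insert fourSixNine_pos h1 (w := circ g₂ g₁)
      (by rw [circ_support fourSixNine_pos]; decide) (by rw [degA_circ]; decide)
      (hcirc g₁ g₂ (by decide)) hp hq
  intro u v huv
  have huniv : (Finset.univ : Finset fourSixNine) ⊆ insert g₃ (insert g₁ (insert g₂ ∅)) := by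
    decide
  exact con_insert fourSixNine_pos h2 (w := circ g₂ g₃)
    (by rw [circ_support fourSixNine_pos]; decide) (by rw [degA_circ]; decide)
    (hcirc g₃ g₂ (by decide)) ((Finset.subset_univ _).trans huniv)
    ((Finset.subset_univ _).trans huniv) huv

end FourSixNine

variable (K : Type*) [Field K]

lemma exists_mem_F5_notMem_F3 : ∃ S ∈ F5 K, S ∉ F3 :=
  ⟨_, (mem_family_iff isMinGenSet_fourSixNine).2 (FourSixNine.toricIdeal_eq K), fun h =>
    FourSixNine.not_universallyFree ((mem_family_iff isMinGenSet_fourSixNine).1 h)⟩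

end CircuitNotFree

end ToricSemigroup

theorem proposition5p2 (K : Type*) [Field K] :
    ToricSemigroup.F0 K ⊂ ToricSemigroup.F1 K ∩ ToricSemigroup.F2 K ∧
    ToricSemigroup.F1 K ∪ ToricSemigroup.F3 ⊆ ToricSemigroup.F4 K ∧
    ToricSemigroup.F2 K ⊆ ToricSemigroup.F3 ∧
    ToricSemigroup.F3 ⊂ ToricSemigroup.F5 K := by
  open ToricSemigroup in
  refine ⟨⟨F0_subset K, fun h => ?_⟩, Set.union_subset (F1_subset_F4 K) (F3_subset_F4 K),
    F2_subset_F3 K, F3_subset_F5 K, fun h => ?_⟩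
  · obtain ⟨S, hS, hS'⟩ := ToricSemigroup.exists_mem_F1_inter_F2_notMem_F0 K
    exact hS' (h hS)
  · obtain ⟨S, hS, hS'⟩ := ToricSemigroup.exists_mem_F5_notMem_F3 K
    exact hS' (h hS)
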